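/- Setting. Let $K,d,n_1,\dots,n_K$ be natural numbers and $m=n_1+\dots+n_K$. For each $k\le K$ let $V_k\subset\mathbb R^{n_k}$ be a finite set of atoms, $\mathcal X_k=\operatorname{conv}V_k$, and let $A_k:\mathbb R^{n_k}\to\mathbb R^d$ be linear. Put $\mathcal X=\mathcal X_1\times\dots\times\mathcal X_K\subset\mathbb R^m$ (a polytope with atoms $V=V_1\times\dots\times V_K$) and $Mx=\sum_k A_kx^{(k)}$. Let $f:\mathbb R^m\to\mathbb R$ be convex and differentiable with $L$-Lipschitz gradient, and generalized strongly convex: $f(x)=g(Bx)+\langle b,x\rangle$ with $B$ linear into some $\mathbb R^p$ and $g$ differentiable and $\mu_g$-strongly convex, $\mu_g>0$. Assume that there are $\bar x^{(k)}\in\operatorname{relint}(\mathcal X_k)$ with $\sum_kA_k\bar x^{(k)}=0$. Let $\lambda>0$ and $$\mathcal L(x,y)=f(x)+\langle y,Mx\rangle+\tfrac\lambda2\|Mx\|^2,\quad d(y)=\min_{x\in\mathcal X}\mathcal L(x,y),\quad d^*=\max_{y}d(y),\quad \mathcal Y^*=\operatorname{argmax} d,$$ $D=\operatorname{diam}\mathcal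 X$ and $L_\lambda=L+\lambda\|M^\top M\|$ (spectral norm); if $L_\lambda D^2=0$, quotients by $L_\lambda D^2$ below are read as $0$. Inner loop. $\mathcal{FW}$ denotes away-step Frank–Wolfe run until its first non-drop step. Its state is a convex combination $x=\sum_{v\in V}\alpha_vv$ with active set $S=\{v:\alpha_v>0\}$. For an objective $\varphi$ it repeats: choose $s\in\operatorname{argmin}_{v\in V}\langle\nabla\varphi(x),v\rangle$ and $v\in\operatorname{argmax}_{v\in S}\langle\nabla\varphi(x),v\rangle$; if $\langle\nabla\varphi(x),x-s\rangle\ge\langle\nabla\varphi(x),v-x\rangle$ take $\delta=s-x$, $\gamma_{\max}=1$, otherwise $\delta=x-v$, $\gamma_{\max}=\alpha_v/(1-\alpha_v)$; choose $\gamma\in\operatorname{argmin}_{[0,\gamma_{\max}]}\varphi(x+\gamma\delta)$; replace $x$ by $x+\gamma\delta$ and update the weights accordingly. It stops after the first pass with $\gamma<\gamma_{\max}$. Say that $\rho_A\in(0,1)$ is a geometric decrease constant if, for all $y\in\mathbb R^d$, all $x\in\mathcal X$ with any decomposition over $V$, and every possible output $x^+$ of $\mathcal{FW}$ started there on $\mathcal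 L(\cdot,y)$, one has $\mathcal L(x^+,y)-\mathcal L(x,y)\le\rho_A\,[\,d(y)-\mathcal L(x,y)\,]$. Algorithm. A run of FW-AL with step size $\eta$: $x_0$ is any convex combination of atoms, $y_0\in\mathbb R^d$ is arbitrary, $x_{t+1}$ is an output of $\mathcal{FW}$ started at $x_t$ (with its current weights) on $\mathcal L(\cdot,y_t)$, and $y_{t+1}=y_t+\eta Mx_{t+1}$. Let $$\Delta_t=\big[\mathcal L(x_{t+1},y_t)-d(y_t)\big]+\big[d^*-d(y_t)\big].$$ Theorem. $\mathcal Y^*\ne\emptyset$, a geometric decrease constant $\rho_A\in(0,1)$ exists, and there is a constant $\alpha>0$, depending only on $f,L,(V_k)_k,(A_k)_k,\lambda$, such that $$d^*-d(y)\ \ge\ \frac{\alpha^2}{2}\min\Big\{\frac{\operatorname{dist}(y,\mathcal Y^*)^2}{L_\lambda D^2},\operatorname{dist}(y,\mathcal Y^*)\Big\}\qquad\forall y\in\mathbb R^d$$ and such that, for every geometric decrease constant $\rho_A\in(0,1)$ and every run of FW-AL with constant step size $\eta=\lambda\rho_A/4$, there is a finite $t_0\ge0$ with $$\Delta_t> L_\lambda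 D^2\quad\text{and}\quad\Delta_{t+1}-\Delta_t\le-\frac{\lambda\alpha^2\rho_A}{8}\quad\text{for all } t<t_0,\qquad \Delta_{t_0}\le L_\lambda D^2,$$ and, for all $t\ge t_0$, $$\Delta_t\le\frac{\Delta_{t_0}}{(1+\rho)^{t-t_0}},\qquad \|Mx_{t+1}\|^2\le\frac{16}{\lambda\rho_A}\,\frac{\Delta_{t_0}}{(1+\rho)^{t-t_0}},\qquad \rho=\min\Big\{\frac{\rho_A}{2},\frac{\rho_A\lambda\alpha^2}{8L_\lambda D^2}\Big\}.$$ Moreover, there is $\alpha>0$ such that $$d^*-d(y)\ge\frac1{2}\min\Big\{\frac{\alpha^2\operatorname{dist}(y,\mathcal Y^*)^2}{L_\lambda D^2},\alpha\operatorname{dist}(y,\mathcal Y^*)\Big\}\qquad\forall y\in\mathbb R^d,$$ and for every $\alpha>0$ with this property, every geometric decrease constant $\rho_A\in(0,1)$ and every such run, the same two-phase conclusion holds with the decrease $\lambda\alpha^2\rho_A/16$ in place of $\lambda\alpha^2\rho_A/8$ and with $\rho=\frac{\rho_A}{2}\min\big\{1,\frac{\lambda\alpha^2}{8L_\lambda D^2}\big\}$.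 -/

import Mathlib

open scoped NNReal

noncomputable section

/-! ## Generalized strong convexity -/

/-- `g` is differentiable and `μ`-strongly convex with respect to the norm of the space. -/
def IsStronglyConvexDiff {F : Type*} [NormedAddCommGroup F] [InnerProductSpace ℝ F]
    [CompleteSpace F] (μ : ℝ) (g : F → ℝ) : Prop :=
  Differentiable ℝ g ∧
    ∀ u u' : F, g u' + inner ℝ (u - u') (gradient g u') + μ / 2 * ‖u - u'‖ ^ 2 ≤ g u

/-- `h x = g (B x) + ⟪b, x⟫` with `B` linear and `g` strongly convex on some `ℝᵖ`. -/
def IsGenStronglyConvex {E : Type*} [NormedAddCommGroup E] [InnerProductSpace ℝ E]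
    (h : E → ℝ) : Prop :=
  ∃ (p : ℕ) (B : E →L[ℝ] EuclideanSpace ℝ (Fin p)) (b : E)
    (g : EuclideanSpace ℝ (Fin p) → ℝ) (μ : ℝ),
    0 < μ ∧ IsStronglyConvexDiff μ g ∧ ∀ x, h x = g (B x) + inner ℝ b x

/-! ## Away-step Frank-Wolfe (one non-drop step)

The atoms are a finite family `a : ι → E`. The state of the algorithm is the vector of weights
`w : ι → ℝ` of the convex decomposition of the current point; the active set is
`{i | 0 < w i}`. -/

section AwayStep

variable {E : Type*} [NormedAddCommGroup E] [InnerProductSpace ℝ E]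
variable {ι : Type*} [Fintype ι]

/-- The point with weights `w` on the atoms. -/
def atomPoint (a : ι → E) (w : ι → ℝ) : E := ∑ i, w i • a i

/-- `γ` is an exact line-search step size: a minimizer of `φ (x + γ d)` on `[0, γmax]`. -/
def IsLineSearch (φ : E → ℝ) (x d : E) (γmax γ : ℝ) : Prop :=
  γ ∈ Set.Icc 0 γmax ∧ ∀ γ' ∈ Set.Icc 0 γmax, φ (x + γ • d) ≤ φ (x + γ' • d)

open scoped Classical in
/-- One pass through the body of the loop, from the weights `w` to the weights `w'`, with step
size `γ` and maximal step size `γmax`. Here `s` is the atom given by the linear minimization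
oracle and `v` is the away atom; all tie-breaking rules are allowed. -/
def AFWStep [CompleteSpace E] (φ : E → ℝ) (a : ι → E) (w : ι → ℝ) (γ γmax : ℝ)
    (w' : ι → ℝ) : Prop :=
  let x := atomPoint a w
  let r := gradient φ x
  ∃ s v : ι,
    (∀ i, inner ℝ r (a s) ≤ inner ℝ r (a i)) ∧
    0 < w v ∧ (∀ i, 0 < w i → inner ℝ r (a i) ≤ inner ℝ r (a v)) ∧
    ((inner ℝ r (a v - x) ≤ inner ℝ r (x - a s) ∧ γmax = 1 ∧
        IsLineSearch φ x (a s - x) γmax γ ∧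
        w' = fun i => (1 - γ) * w i + γ * (if i = s then 1 else 0)) ∨
     (inner ℝ r (x - a s) < inner ℝ r (a v - x) ∧ γmax = w v / (1 - w v) ∧
        IsLineSearch φ x (x - a v) γmax γ ∧
        w' = fun i => (1 + γ) * w i - γ * (if i = v then 1 else 0)))

/-- `AFW φ a w w'`: the algorithm, started on the objective `φ` with the weights `w`, can stop
with the weights `w'`. It repeats steps with `γ = γmax` until the first step with `γ < γmax`. -/
inductive AFW [CompleteSpace E] (φ : E → ℝ) (a : ι → E) : (ι → ℝ) → (ι → ℝ) → Prop
  | last {w w' : ι → ℝ} {γ γmax : ℝ} (hstep : AFWStep φ a w γ γmax w') (hγ : γ < γmax) :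
      AFW φ a w w'
  | drop {w w' w'' : ι → ℝ} {γ γmax : ℝ} (hstep : AFWStep φ a w γ γmax w')
      (hγ : ¬ γ < γmax) (hnext : AFW φ a w' w'') : AFW φ a w w''

end AwayStep

/-! ## The splitting problem -/

/-- The space `ℝᵐ = ℝ^{n 1} × ⋯ × ℝ^{n K}` with the Euclidean norm. -/
abbrev BlockSpace {K : ℕ} (n : Fin K → ℕ) : Type :=
  PiLp 2 (fun k => EuclideanSpace ℝ (Fin (n k)))

/-- The data of `min f(x⁽¹⁾, …, x⁽ᴷ⁾)` subject to `x⁽ᵏ⁾ ∈ conv (V k)` and `∑ₖ Aₖ x⁽ᵏ⁾ = 0`,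
where each `V k` is a finite set of atoms, with the parameter `lam` of the augmented Lagrangian. -/
structure SplitProblem (K d : ℕ) (n : Fin K → ℕ) where
  f : BlockSpace n → ℝ
  V : ∀ k, Finset (EuclideanSpace ℝ (Fin (n k)))
  A : ∀ k, EuclideanSpace ℝ (Fin (n k)) →L[ℝ] EuclideanSpace ℝ (Fin d)
  lam : ℝ

namespace SplitProblem

variable {K d : ℕ} {n : Fin K → ℕ} (P : SplitProblem K d n)

/-- The polytope of the block `k`. -/
def Xk (k : Fin K) : Set (EuclideanSpace ℝ (Fin (n k))) :=
  convexHull ℝ (P.V k : Set (EuclideanSpace ℝ (Fin (n k))))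

/-- The product of the block polytopes. -/
def X : Set (BlockSpace n) := {x | ∀ k, x k ∈ P.Xk k}

/-- `M x = ∑ₖ Aₖ x⁽ᵏ⁾`. -/
def M : BlockSpace n →L[ℝ] EuclideanSpace ℝ (Fin d) :=
  ∑ k, (P.A k).comp (PiLp.proj 2 (fun k => EuclideanSpace ℝ (Fin (n k))) k)

/-- Interior qualification. -/
def Slater : Prop :=
  ∃ x : BlockSpace n, (∀ k, x k ∈ intrinsicInterior ℝ (P.Xk k)) ∧ ∑ k, P.A k (x k) = 0

/-- The augmented Lagrangian. -/
def lagr (x : BlockSpace n) (y : EuclideanSpace ℝ (Fin d)) : ℝ :=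
  P.f x + inner ℝ y (P.M x) + P.lam / 2 * ‖P.M x‖ ^ 2

/-- The augmented dual function `d(y) = min_{x ∈ X} 𝓛(x, y)`. -/
def dual (y : EuclideanSpace ℝ (Fin d)) : ℝ := ⨅ x : P.X, P.lagr x y

/-- `d* = max_y d(y)`. -/
def dualOpt : ℝ := ⨆ y, P.dual y

/-- The set `𝓨*` of maximizers of the augmented dual function. -/
def dualSolutions : Set (EuclideanSpace ℝ (Fin d)) := {y | ∀ y', P.dual y' ≤ P.dual y}

/-- `L_λ D²` with `L_λ = L + λ ‖Mᵀ M‖` and `D` the diameter of `X`. -/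
def LD2 (L : ℝ≥0) : ℝ :=
  (L + P.lam * ‖(ContinuousLinearMap.adjoint P.M).comp P.M‖) * Metric.diam P.X ^ 2

/-- `d* - d(y) ≥ (α² / 2) min {dist(y, 𝓨*)² / (L_λ D²), dist(y, 𝓨*)}` for all `y`. -/
def ErrorBound (L : ℝ≥0) (α : ℝ) : Prop :=
  ∀ y, α ^ 2 / 2 * min (Metric.infDist y P.dualSolutions ^ 2 / P.LD2 L)
      (Metric.infDist y P.dualSolutions) ≤ P.dualOpt - P.dual y

/-- `d* - d(y) ≥ (1 / 2) min {α² dist(y, 𝓨*)² / (L_λ D²), α dist(y, 𝓨*)}` for all `y`. -/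
def ErrorBound' (L : ℝ≥0) (α : ℝ) : Prop :=
  ∀ y, 1 / 2 * min (α ^ 2 * Metric.infDist y P.dualSolutions ^ 2 / P.LD2 L)
      (α * Metric.infDist y P.dualSolutions) ≤ P.dualOpt - P.dual y

/-- Indices of the atoms of `X`: one atom for each block. -/
abbrev AtomIdx : Type := ∀ k, {v // v ∈ P.V k}

/-- The atoms of `X`. -/
def atom (i : P.AtomIdx) : BlockSpace n := WithLp.toLp 2 (fun k => (i k).1)

/-- Geometric decrease of away-step Frank-Wolfe (one non-drop step) on `𝓛(·, y)`, uniformly in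
`y`, in the current point and in its decomposition. -/
def GeometricDecrease (ρA : ℝ) : Prop :=
  ∀ (y : EuclideanSpace ℝ (Fin d)) (w w' : P.AtomIdx → ℝ), w ∈ stdSimplex ℝ P.AtomIdx →
    AFW (fun x => P.lagr x y) P.atom w w' →
    P.lagr (atomPoint P.atom w') y - P.lagr (atomPoint P.atom w) y
      ≤ ρA * (P.dual y - P.lagr (atomPoint P.atom w) y)

/-- A run of FW-AL with away-step Frank-Wolfe (one non-drop step) as inner loop and constant dual
step size `η`: `w t` are the weights of `x_t = atomPoint P.atom (w t)`, and `y t` is the dual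
iterate. -/
structure IsRun (η : ℝ) (w : ℕ → P.AtomIdx → ℝ) (y : ℕ → EuclideanSpace ℝ (Fin d)) : Prop where
  init : w 0 ∈ stdSimplex ℝ P.AtomIdx
  primal : ∀ t, AFW (fun x => P.lagr x (y t)) P.atom (w t) (w (t + 1))
  multiplier : ∀ t, y (t + 1) = y t + η • P.M (atomPoint P.atom (w (t + 1)))

/-- `Δ_t = (𝓛(x_{t+1}, y_t) - d(y_t)) + (d* - d(y_t))`. -/
def gap (w : ℕ → P.AtomIdx → ℝ) (y : ℕ → EuclideanSpace ℝ (Fin d)) (t : ℕ) : ℝ :=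
  (P.lagr (atomPoint P.atom (w (t + 1))) (y t) - P.dual (y t)) + (P.dualOpt - P.dual (y t))

/-- The two phases: `Δ_t` decreases by at least `c` at each of the first `t₀` steps, until
`Δ_{t₀} ≤ L_λ D²`; from then on `Δ_t` and `‖M x_{t+1}‖²` decrease linearly, with the factor
`(1 + ρ)⁻¹`. -/
def TwoPhase (L : ℝ≥0) (ρA c ρ : ℝ) (w : ℕ → P.AtomIdx → ℝ)
    (y : ℕ → EuclideanSpace ℝ (Fin d)) : Prop :=
  ∃ t₀ : ℕ,
    (∀ t < t₀, P.LD2 L < P.gap w y t ∧ P.gap w y (t + 1) - P.gap w y t ≤ -c) ∧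
    P.gap w y t₀ ≤ P.LD2 L ∧
    ∀ t ≥ t₀,
      P.gap w y t ≤ P.gap w y t₀ / (1 + ρ) ^ (t - t₀) ∧
      ‖P.M (atomPoint P.atom (w (t + 1)))‖ ^ 2
        ≤ 16 / (P.lam * ρA) * (P.gap w y t₀ / (1 + ρ) ^ (t - t₀))

end SplitProblem

end

/-!
Everything rests on Hoffman's error bound for polyhedra (`hoffman_bound`), which is proved here from
Carathéodory's theorem and Farkas' lemma for finitely generated cones. It is used twice.

*Inner loop.* The gradient of `𝓛(·, y)` at `x` has the form `C† z + b`, where `C = (B, M)` and `b` do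
not depend on `y`, and `𝓛(·, y)` is strongly convex along `C` uniformly in `y`. If the pairwise gap
at `x` is `g`, then Hoffman's bound moves `z` by `O(g)` to a `z'` for which the active atoms minimize
`C† z' + b` exactly; strong convexity then gives `𝓛(x, y) - d(y) = O(g²)` with a constant independent
of `y` (`exists_primal_bound`). The last step of the inner loop is a line search which is not stopped
by the maximal step size, so it gains at least `g² / (8 L_λ D²)`, and a geometric decrease constant
exists.

*Dual error bound.* At a primal solution `x₀` the dual solutions are the KKT multipliers, a polyhedron
that is nonempty by Farkas' lemma. Its residual at `y` is the Frank-Wolfe gap `G` of `𝓛(·, y)` at `x₀`.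
Since `𝓛(x₀, y) = d*` and `d` is a minimum over `X`, a Frank-Wolfe step from `x₀` shows
`d* - d(y) ≥ max_{τ ∈ [0, 1]} (τ G - τ² L_λ D² / 2)`, and Hoffman's bound `dist(y, 𝓨*) ≤ C G` turns this
into the error bound with `α = 1 / C`.

*Two phases.* Write `Δ = p + q` with the primal gap `p` and the dual gap `q`. The dual function is
concave with gradient `M x̂(y)`, and `𝓛(x, y) - d(y) ≥ λ / 2 * ‖M x - M x̂(y)‖²`. With `η = λ ρ_A / 4` this
gives `Δ_{t+1} - Δ_t ≤ -(ρ_A / 2) p_{t+1} - (λ ρ_A / 4) ‖M x̂(y_{t+1})‖²` (`gap_succ_sub_le`). By concavity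
`q ≤ ‖M x̂(y)‖ dist(y, 𝓨*)`, so the error bound yields
`‖M x̂(y)‖² ≥ (α² / 2) min {q / (L_λ D²), 1 / 2}`, and the claims follow from this scalar recurrence.
When `Δ_t` jumps over the threshold the constant decrease needs `λ α² ≤ L_λ D²`, which holds
because the dual gap is at most `dist² / (2 λ)` (`lam_mul_sq_le`). If all multipliers are optimal, then
`α` is not restricted, but then `Δ_0 ≤ L_λ D² / 2` already after the first inner loop.
-/

/-! ### Finitely generated cones -/

section Cones

variable {V : Type*} [NormedAddCommGroup V] [NormedSpace ℝ V] {ι : Type*} [Fintype ι]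

open scoped Classical in
/-- **Carathéodory's theorem for cones.** A nonnegative combination can be rewritten with a
linearly independent support. -/
theorem exists_linearIndependent_conic (a : ι → V) (c : ι → ℝ) (hc : ∀ i, 0 ≤ c i) :
    ∃ c' : ι → ℝ, (∀ i, 0 ≤ c' i) ∧ ∑ i, c' i • a i = ∑ i, c i • a i ∧
      (∀ i, c i = 0 → c' i = 0) ∧
      LinearIndependent ℝ (fun i : {i // i ∈ Finset.univ.filter fun i => c' i ≠ 0} => a i) := by
  induction hN : (Finset.univ.filter fun i => c i ≠ 0).card using Nat.strong_induction_on
    generalizing c with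
  | _ N ih =>
  by_cases hli : LinearIndependent ℝ (fun i : {i // i ∈ Finset.univ.filter fun i => c i ≠ 0} => a i)
  · exact ⟨c, hc, rfl, fun _ h => h, hli⟩
  -- a nontrivial relation with a positive coefficient, extended by zero off the support
  obtain ⟨g, hg, hg0, i₁, hi₁⟩ : ∃ g : ι → ℝ, ∑ i, g i • a i = 0 ∧ (∀ i, c i = 0 → g i = 0) ∧
      ∃ i, 0 < g i := by
    rw [Fintype.not_linearIndependent_iff] at hli
    obtain ⟨g, hg, i, hi⟩ := hli
    let g' : ι → ℝ := fun i => if h : i ∈ Finset.univ.filter fun i => c i ≠ 0 then g ⟨i, h⟩ else 0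
    have hsum : ∑ i, g' i • a i = 0 := by
      rw [← hg, ← Finset.sum_subset (Finset.subset_univ (Finset.univ.filter fun i => c i ≠ 0)),
        ← Finset.sum_coe_sort]
      · refine Finset.sum_congr rfl fun i _ => ?_
        simp only [g', i.2, dif_pos]
      · intro i _ h
        simp only [g', h, dif_neg, not_false_eq_true, zero_smul]
    have hz : ∀ i, c i = 0 → g' i = 0 := fun i h => by simp [g', h]
    have hgi : g' i = g i := by simp only [g', i.2, dif_pos]
    rcases lt_or_gt_of_ne hi with h | h
    · exact ⟨-g', by simp [hsum], fun i h => by simp [hz i h], i, by simpa [hgi] using h⟩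
    · exact ⟨g', hsum, hz, i, by rwa [hgi]⟩
  obtain ⟨i₀, hi₀, hmin⟩ := Finset.exists_min_image (Finset.univ.filter fun i => 0 < g i)
    (fun i => c i / g i) ⟨i₁, by simpa using hi₁⟩
  have hgi₀ : 0 < g i₀ := by simpa using hi₀
  have ht : 0 ≤ c i₀ / g i₀ := div_nonneg (hc _) hgi₀.le
  have hnew : ∀ i, 0 ≤ c i - c i₀ / g i₀ * g i := by
    intro i
    by_cases hgi : 0 < g i
    · have := hmin i (by simpa using hgi)
      rw [le_div_iff₀ hgi] at this
      linarith
    · have := mul_nonpos_of_nonneg_of_nonpos ht (not_lt.1 hgi)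
      linarith [hc i]
  have hzero : ∀ i, c i = 0 → c i - c i₀ / g i₀ * g i = 0 := fun i h => by simp [h, hg0 i h]
  have hci₀ : c i₀ ≠ 0 := fun h => hgi₀.ne' (hg0 _ h)
  obtain ⟨c', h1, h2, h3, h4⟩ := ih _ (by
    rw [← hN]
    refine Finset.card_lt_card ⟨?_, fun hsub => ?_⟩
    · intro i
      simp only [Finset.mem_filter, Finset.mem_univ, true_and]
      exact fun h h' => h (hzero i h')
    · have := @hsub i₀ (by simpa using hci₀)
      simp only [Finset.mem_filter, Finset.mem_univ, true_and] at this
      exact this (by field_simp; ring)) (fun i => c i - c i₀ / g i₀ * g i) hnew rfl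
  refine ⟨c', h1, ?_, fun i h => h3 i (hzero i h), h4⟩
  rw [h2]
  simp only [sub_smul, Finset.sum_sub_distrib, mul_smul, ← Finset.smul_sum, hg, smul_zero, sub_zero]

open scoped Classical in
/-- Every element of a finitely generated cone is a nonnegative combination of the generators whose
coefficients are bounded linearly by its norm. -/
theorem exists_conic_bound (a : ι → V) :
    ∃ C : ℝ, 0 < C ∧ ∀ c : ι → ℝ, (∀ i, 0 ≤ c i) → ∃ c' : ι → ℝ, (∀ i, 0 ≤ c' i) ∧
      ∑ i, c' i • a i = ∑ i, c i • a i ∧ (∀ i, c i = 0 → c' i = 0) ∧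
      ∑ i, c' i ≤ C * ‖∑ i, c i • a i‖ := by
  have key : ∀ s : Finset ι, ∃ C : ℝ, 0 ≤ C ∧
      (LinearIndependent ℝ (fun i : {i // i ∈ s} => a i) →
        ∀ c : ι → ℝ, ∑ i ∈ s, c i ≤ C * ‖∑ i ∈ s, c i • a i‖) := by
    intro s
    by_cases h : LinearIndependent ℝ (fun i : {i // i ∈ s} => a i)
    · have hker : LinearMap.ker (Fintype.linearCombination ℝ (fun i : {i // i ∈ s} => a i)) = ⊥ :=
        LinearMap.ker_eq_bot.2 (linearIndependent_iff_injective_fintypeLinearCombination.1 h)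
      obtain ⟨C, -, hC⟩ := LinearMap.exists_antilipschitzWith _ hker
      refine ⟨s.card * C, by positivity, fun _ c => ?_⟩
      have h1 := hC.le_mul_norm (by simp) (fun i : {i // i ∈ s} => c i)
      rw [Fintype.linearCombination_apply,
        Finset.sum_coe_sort s (fun i => c i • a i)] at h1
      have h2 : ∑ i ∈ s, c i ≤ s.card • ‖fun i : {i // i ∈ s} => c i‖ :=
        Finset.sum_le_card_nsmul _ _ _ fun i hi =>
          (le_abs_self _).trans (norm_le_pi_norm (fun i : {i // i ∈ s} => c i) ⟨i, hi⟩)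
      rw [nsmul_eq_mul] at h2
      calc _ ≤ _ := h2
        _ ≤ s.card * (C * ‖∑ i ∈ s, c i • a i‖) := by gcongr
        _ = _ := by ring
    · exact ⟨0, le_rfl, fun h' => absurd h' h⟩
  choose C hC0 hC using key
  refine ⟨∑ s, C s + 1, by have := Finset.sum_nonneg fun s (_ : s ∈ Finset.univ) => hC0 s; linarith,
    fun c hc => ?_⟩
  obtain ⟨c', h1, h2, h3, h4⟩ := exists_linearIndependent_conic a c hc
  refine ⟨c', h1, h2, h3, ?_⟩
  have h5 := hC _ h4 c'
  have e1 : ∑ i ∈ Finset.univ.filter (fun i => c' i ≠ 0), c' i = ∑ i, c' i :=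
    Finset.sum_filter_ne_zero _
  have e2 : ∑ i ∈ Finset.univ.filter (fun i => c' i ≠ 0), c' i • a i = ∑ i, c' i • a i := by
    refine Finset.sum_subset (Finset.subset_univ _) fun i _ hi => ?_
    simp only [Finset.mem_filter, Finset.mem_univ, true_and, not_not] at hi
    simp [hi]
  rw [e1, e2, h2] at h5
  refine h5.trans (mul_le_mul_of_nonneg_right ?_ (norm_nonneg _))
  linarith [Finset.single_le_sum (f := C) (fun s _ => hC0 s)
    (Finset.mem_univ (Finset.univ.filter (fun i => c' i ≠ 0)))]

/-- A finitely generated cone is closed. -/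
theorem isClosed_conic (a : ι → V) :
    IsClosed {x : V | ∃ c : ι → ℝ, (∀ i, 0 ≤ c i) ∧ ∑ i, c i • a i = x} := by
  obtain ⟨C, hC0, hC⟩ := exists_conic_bound a
  refine isClosed_of_closure_subset fun x hx => ?_
  -- near `x` the cone is the image of a compact set of coefficients
  let T : Set V := (fun c : ι → ℝ => ∑ i, c i • a i) ''
    Set.Icc (fun _ => (0 : ℝ)) (fun _ => C * (‖x‖ + 1))
  have hT : IsClosed T := (isCompact_Icc.image (by fun_prop)).isClosed
  have hxT : x ∈ closure T := by
    rw [Metric.mem_closure_iff] at hx ⊢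
    intro ε hε
    obtain ⟨_, ⟨c, hc, rfl⟩, hd⟩ := hx (min ε 1) (by positivity)
    obtain ⟨c', h1, h2, -, h4⟩ := hC c hc
    have hn : ‖∑ i, c i • a i‖ ≤ ‖x‖ + 1 := by
      have := norm_le_norm_add_norm_sub' (∑ i, c i • a i) x
      rw [dist_eq_norm, norm_sub_rev] at hd
      linarith [min_le_right ε 1]
    refine ⟨_, ⟨c', ⟨h1, fun i => ?_⟩, h2⟩, hd.trans_le (min_le_left _ _)⟩
    calc c' i ≤ ∑ i, c' i := Finset.single_le_sum (fun i _ => h1 i) (Finset.mem_univ i)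
      _ ≤ _ := h4
      _ ≤ _ := mul_le_mul_of_nonneg_left hn hC0.le
  rw [hT.closure_eq] at hxT
  obtain ⟨c, hc, rfl⟩ := hxT
  exact ⟨c, hc.1, rfl⟩

/-- **Farkas' lemma** for a finitely generated cone. -/
theorem exists_conic_or_separating (a : ι → V) (x : V) :
    (∃ c : ι → ℝ, (∀ i, 0 ≤ c i) ∧ ∑ i, c i • a i = x) ∨
      ∃ f : V →L[ℝ] ℝ, (∀ i, f (a i) ≤ 0) ∧ 0 < f x := by
  classical
  by_cases hx : ∃ c : ι → ℝ, (∀ i, 0 ≤ c i) ∧ ∑ i, c i • a i = x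
  · exact Or.inl hx
  right
  have hconv : Convex ℝ {x : V | ∃ c : ι → ℝ, (∀ i, 0 ≤ c i) ∧ ∑ i, c i • a i = x} := by
    rintro _ ⟨c, hc, rfl⟩ _ ⟨c', hc', rfl⟩ s t hs ht -
    refine ⟨s • c + t • c', fun i => ?_, ?_⟩
    · have := hc i; have := hc' i
      simp only [Pi.add_apply, Pi.smul_apply, smul_eq_mul]; positivity
    · simp [add_smul, Finset.sum_add_distrib, Finset.smul_sum, mul_smul]
  obtain ⟨f, u, hf, hu⟩ := geometric_hahn_banach_closed_point hconv (isClosed_conic a) hx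
  have hu0 : 0 < u := by simpa using hf 0 ⟨0, by simp⟩
  refine ⟨f, fun i => ?_, hu0.trans hu⟩
  by_contra! hi
  have := hf ((u / f (a i)) • a i) ⟨Pi.single i (u / f (a i)), fun j => ?_, ?_⟩
  · rw [map_smul, smul_eq_mul, div_mul_cancel₀ _ hi.ne'] at this
    exact lt_irrefl _ this
  · by_cases h : j = i
    · subst h; simp; positivity
    · simp [h]
  · simp [Pi.single_apply]

end Cones

/-! ### Systems of affine inequalities -/

section Hoffman

variable {F : Type*} [NormedAddCommGroup F] [InnerProductSpace ℝ F] [FiniteDimensional ℝ F]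
  {ι : Type*} [Fintype ι]

/-- Farkas' alternative for an infeasible system of affine inequalities. -/
theorem exists_conic_of_infeasible (a : ι → F) (β : ι → ℝ)
    (h : ¬ ∃ z : F, ∀ i, inner ℝ (a i) z ≤ β i) :
    ∃ c : ι → ℝ, (∀ i, 0 ≤ c i) ∧ ∑ i, c i • a i = 0 ∧ ∑ i, c i * β i = -1 := by
  rcases exists_conic_or_separating (fun i => (a i, β i)) ((0, -1) : F × ℝ) with ⟨c, hc, h1⟩ | ⟨f, hf, h1⟩
  · refine ⟨c, hc, ?_, ?_⟩
    · simpa [Prod.fst_sum] using congrArg Prod.fst h1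
    · simpa [Prod.snd_sum] using congrArg Prod.snd h1
  · exfalso
    set z := (InnerProductSpace.toDual ℝ F).symm (f.comp (ContinuousLinearMap.inl ℝ F ℝ)) with hz
    set s := f (0, 1) with hs
    have hsplit : ∀ u τ, f (u, τ) = inner ℝ u z + τ * s := by
      intro u τ
      have : (u, τ) = ContinuousLinearMap.inl ℝ F ℝ u + τ • ((0, 1) : F × ℝ) := by simp
      rw [this, map_add, map_smul, real_inner_comm, hz, InnerProductSpace.toDual_symm_apply]
      simp [hs]
    rw [hsplit] at h1
    simp only [inner_zero_left, zero_add, neg_mul, one_mul] at h1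
    refine h ⟨(-s)⁻¹ • z, fun i => ?_⟩
    have := hf i
    rw [hsplit] at this
    rw [real_inner_smul_right, inv_mul_le_iff₀ h1]
    linarith

/-- The residual of an infeasible system of affine inequalities is bounded away from zero. -/
theorem exists_pos_residual_of_infeasible (a : ι → F) (β : ι → ℝ)
    (h : ¬ ∃ z : F, ∀ i, inner ℝ (a i) z ≤ β i) :
    ∃ ε₀ : ℝ, 0 < ε₀ ∧ ∀ (z : F) (ε : ℝ), (∀ i, inner ℝ (a i) z ≤ β i + ε) → ε₀ ≤ ε := by
  obtain ⟨c, hc, h1, h2⟩ := exists_conic_of_infeasible a β h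
  have key : ∀ (z : F) (ε : ℝ), (∀ i, inner ℝ (a i) z ≤ β i + ε) → 1 ≤ (∑ i, c i) * ε := by
    intro z ε hz
    have e1 : ∑ i, c i * inner ℝ (a i) z = 0 := by
      simp only [← real_inner_smul_left]
      rw [← sum_inner, h1, inner_zero_left]
    have e2 : ∑ i, c i * inner ℝ (a i) z ≤ ∑ i, c i * (β i + ε) :=
      Finset.sum_le_sum fun i _ => mul_le_mul_of_nonneg_left (hz i) (hc i)
    simp only [mul_add, Finset.sum_add_distrib, h2, ← Finset.sum_mul] at e2
    linarith
  have hpos : 0 < ∑ i, c i := by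
    rcases (Finset.sum_nonneg fun i (_ : i ∈ Finset.univ) => hc i).lt_or_eq with h | h
    · exact h
    · have : ∀ i, c i = 0 := fun i => (Finset.sum_eq_zero_iff_of_nonneg fun i _ => hc i).1 h.symm i
        (Finset.mem_univ i)
      simp [this] at h2
  refine ⟨(∑ i, c i)⁻¹, inv_pos.2 hpos, fun z ε hz => ?_⟩
  rw [inv_le_iff_one_le_mul₀' hpos]
  exact key z ε hz

open Filter Topology in
/-- **Hoffman's error bound**: the distance to a nonempty polyhedron is bounded linearly by the
residual. The displacement to the nearest point lies in the cone of the active constraints, and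
its coefficients are bounded by `exists_conic_bound`. -/
theorem hoffman_bound (a : ι → F) (β : ι → ℝ) (h : ∃ z : F, ∀ i, inner ℝ (a i) z ≤ β i) :
    ∃ C : ℝ, 0 < C ∧ ∀ (z : F) (ε : ℝ), 0 ≤ ε → (∀ i, inner ℝ (a i) z ≤ β i + ε) →
      ∃ z' : F, (∀ i, inner ℝ (a i) z' ≤ β i) ∧ ‖z - z'‖ ≤ C * ε := by
  classical
  obtain ⟨C, hC0, hC⟩ := exists_conic_bound a
  refine ⟨C, hC0, fun z ε hε hz => ?_⟩
  set Q : Set F := {z | ∀ i, inner ℝ (a i) z ≤ β i} with hQ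
  have hQc : IsClosed Q := by
    simp only [hQ, Set.ofPred_forall]
    exact isClosed_iInter fun i => isClosed_le (by fun_prop) continuous_const
  have hQconv : Convex ℝ Q := by
    intro u hu v hv s t hs ht hst i
    rw [inner_add_right, real_inner_smul_right, real_inner_smul_right]
    have e : β i = s * β i + t * β i := by rw [← add_mul, hst, one_mul]
    rw [e]
    exact add_le_add (mul_le_mul_of_nonneg_left (hu i) hs) (mul_le_mul_of_nonneg_left (hv i) ht)
  obtain ⟨p, hp, hmin⟩ := exists_norm_eq_iInf_of_complete_convex (K := Q) h hQc.isComplete hQconv z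
  rw [norm_eq_iInf_iff_real_inner_le_zero hQconv hp] at hmin
  refine ⟨p, hp, ?_⟩
  obtain ⟨c, hc, hca, hcz⟩ : ∃ c : ι → ℝ, (∀ i, 0 ≤ c i) ∧
      (∀ i, inner ℝ (a i) p ≠ β i → c i = 0) ∧ ∑ i, c i • a i = z - p := by
    rcases exists_conic_or_separating (fun i => if inner ℝ (a i) p = β i then a i else 0) (z - p)
      with ⟨c, hc, h1⟩ | ⟨f, hf, h1⟩
    · refine ⟨fun i => if inner ℝ (a i) p = β i then c i else 0, fun i => ?_, fun i hi => ?_, ?_⟩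
      · dsimp only; split_ifs <;> simp [hc]
      · simp [hi]
      · rw [← h1]
        refine Finset.sum_congr rfl fun i _ => ?_
        by_cases hi : inner ℝ (a i) p = β i <;> simp [hi]
    · exfalso
      set u := (InnerProductSpace.toDual ℝ F).symm f with hu
      have hfu : ∀ x, f x = inner ℝ x u := fun x => by
        rw [real_inner_comm, hu, InnerProductSpace.toDual_symm_apply]
      have hev : ∀ᶠ s : ℝ in 𝓝[>] 0, ∀ i, inner ℝ (a i) (p + s • u) ≤ β i := by
        rw [eventually_all]
        intro i
        by_cases hi : inner ℝ (a i) p = β i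
        · filter_upwards [self_mem_nhdsWithin] with s hs
          have := hf i
          rw [if_pos hi, hfu] at this
          rw [inner_add_right, real_inner_smul_right, hi]
          have := mul_nonpos_of_nonneg_of_nonpos (le_of_lt hs) this
          linarith
        · have hlt : inner ℝ (a i) p < β i := lt_of_le_of_ne (hp i) hi
          have hcont : Tendsto (fun s : ℝ => inner ℝ (a i) (p + s • u)) (𝓝 0)
              (𝓝 (inner ℝ (a i) (p + (0 : ℝ) • u))) := by
            apply Continuous.tendsto
            fun_prop
          rw [zero_smul, add_zero] at hcont
          filter_upwards [nhdsWithin_le_nhds (hcont.eventually_lt_const hlt)] with s hs using hs.le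
      obtain ⟨s, hs, hs0⟩ := (hev.and self_mem_nhdsWithin).exists
      have := hmin _ hs
      rw [add_sub_cancel_left, real_inner_smul_right, ← hfu] at this
      exact absurd this (not_le.2 (mul_pos hs0 h1))
  obtain ⟨c', h1, h2, h3, h4⟩ := hC c hc
  rw [hcz] at h2 h4
  have hsq : ‖z - p‖ * ‖z - p‖ ≤ ‖z - p‖ * (C * ε) := by
    calc ‖z - p‖ * ‖z - p‖ = inner ℝ (∑ i, c' i • a i) (z - p) := by
          rw [h2, real_inner_self_eq_norm_mul_norm]
      _ = ∑ i, c' i * inner ℝ (a i) (z - p) := by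
          rw [sum_inner]; simp only [real_inner_smul_left]
      _ ≤ ∑ i, c' i * ε := by
          refine Finset.sum_le_sum fun i _ => ?_
          by_cases hi : inner ℝ (a i) p = β i
          · refine mul_le_mul_of_nonneg_left ?_ (h1 i)
            rw [inner_sub_right, hi]
            linarith [hz i]
          · rw [h3 i (hca i hi)]; simp
      _ = (∑ i, c' i) * ε := by rw [Finset.sum_mul]
      _ ≤ C * ‖z - p‖ * ε := by gcongr
      _ = _ := by ring
  rcases (norm_nonneg (z - p)).eq_or_lt with h0 | h0
  · rw [← h0]; positivity
  · exact le_of_mul_le_mul_left hsq h0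

end Hoffman

/-! ### Away-step Frank-Wolfe -/

section AwayStepAnalysis

variable {E : Type*} [NormedAddCommGroup E] [InnerProductSpace ℝ E] {ι : Type*} [Fintype ι]

theorem atomPoint_mem_convexHull (a : ι → E) {w : ι → ℝ} (hw : w ∈ stdSimplex ℝ ι) :
    atomPoint a w ∈ convexHull ℝ (Set.range a) :=
  (convex_convexHull ℝ _).sum_mem (fun i _ => hw.1 i) hw.2
    fun i _ => subset_convexHull ℝ _ ⟨i, rfl⟩

theorem inner_le_of_mem_convexHull {κ : Type*} (a : κ → E) {r : E} {t : ℝ} (h : ∀ i, inner ℝ r (a i) ≤ t)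
    {x : E} (hx : x ∈ convexHull ℝ (Set.range a)) : inner ℝ r x ≤ t := by
  have hconv : Convex ℝ {x : E | inner ℝ r x ≤ t} :=
    convex_halfSpace_le (IsLinearMap.mk (fun _ _ => inner_add_right _ _ _)
      (fun _ _ => real_inner_smul_right _ _ _)) t
  refine convexHull_min ?_ hconv hx
  rintro _ ⟨i, rfl⟩
  exact h i

/-- A bound on `⟪r, v - u⟫` for active atoms `v` and all atoms `u` bounds the linear gap at the
current point. -/
theorem inner_atomPoint_sub_le (a : ι → E) {w : ι → ℝ} (hw : w ∈ stdSimplex ℝ ι) {r : E} {g : ℝ}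
    (h : ∀ i j, 0 < w i → inner ℝ r (a i - a j) ≤ g) {x : E}
    (hx : x ∈ convexHull ℝ (Set.range a)) : inner ℝ r (atomPoint a w - x) ≤ g := by
  have h1 : ∀ i, 0 < w i → inner ℝ r (a i) - g ≤ inner ℝ r x := by
    intro i hi
    have := inner_le_of_mem_convexHull a (r := -r) (t := g - inner ℝ r (a i)) (fun j => by
      have := h i j hi
      rw [inner_sub_right] at this
      rw [inner_neg_left]
      linarith) hx
    rw [inner_neg_left] at this
    linarith
  have h2 : inner ℝ r (atomPoint a w) ≤ ∑ i, w i * (inner ℝ r x + g) := by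
    rw [atomPoint, inner_sum]
    refine Finset.sum_le_sum fun i _ => ?_
    rw [real_inner_smul_right]
    rcases (hw.1 i).eq_or_lt with h0 | h0
    · simp [← h0]
    · exact mul_le_mul_of_nonneg_left (by linarith [h1 i h0]) h0.le
  rw [← Finset.sum_mul, hw.2, one_mul] at h2
  rw [inner_sub_right]
  linarith

section PrimalErrorBound

variable [FiniteDimensional ℝ E] {Z : Type*} [NormedAddCommGroup Z] [InnerProductSpace ℝ Z]
  [FiniteDimensional ℝ Z]

open scoped Classical in
theorem exists_primal_bound_of_support (a : ι → E) (C : E →L[ℝ] Z) (b : E) {ν : ℝ} (hν : 0 < ν)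
    (S : Finset ι) :
    ∃ κ : ℝ, 0 < κ ∧ ∀ w ∈ stdSimplex ℝ ι, (∀ i, 0 < w i → i ∈ S) → ∀ (z : Z) (g : ℝ), 0 ≤ g →
      (∀ i j, i ∈ S → inner ℝ (C.adjoint z + b) (a i - a j) ≤ g) →
      ∀ x ∈ convexHull ℝ (Set.range a),
        inner ℝ (C.adjoint z + b) (atomPoint a w - x) - ν / 2 * ‖C (atomPoint a w - x)‖ ^ 2
          ≤ κ * g ^ 2 := by
  let A : ι × ι → Z := fun q => if q.1 ∈ S then C (a q.1 - a q.2) else 0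
  let β : ι × ι → ℝ := fun q => if q.1 ∈ S then -inner ℝ b (a q.1 - a q.2) else 0
  have hexp : ∀ z u, inner ℝ (C.adjoint z + b) u = inner ℝ (C u) z + inner ℝ b u := fun z u => by
    rw [inner_add_left, ContinuousLinearMap.adjoint_inner_left, real_inner_comm]
  have hsys : ∀ (z : Z) (ε : ℝ), 0 ≤ ε → ((∀ q, inner ℝ (A q) z ≤ β q + ε) ↔
      ∀ i j, i ∈ S → inner ℝ (C.adjoint z + b) (a i - a j) ≤ ε) := by
    intro z ε hε
    constructor
    · intro h i j hi
      have := h (i, j)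
      simp only [A, β, hi, if_true] at this
      rw [hexp]
      linarith
    · rintro h ⟨i, j⟩
      by_cases hi : i ∈ S
      · have := h i j hi
        rw [hexp] at this
        simp only [A, β, hi, if_true]
        linarith
      · simpa [A, β, hi] using hε
  by_cases hfeas : ∃ z : Z, ∀ q, inner ℝ (A q) z ≤ β q
  · obtain ⟨K, hK, hH⟩ := hoffman_bound A β hfeas
    refine ⟨K ^ 2 / (2 * ν), by positivity, fun w hw hwS z g hg h x hx => ?_⟩
    obtain ⟨z', hz', hd⟩ := hH z g hg ((hsys z g hg).2 h)
    have hz'' := (hsys z' 0 le_rfl).1 (by simpa using hz')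
    have h0 := inner_atomPoint_sub_le a hw (fun i j hi => hz'' i j (hwS i hi)) hx
    set u := atomPoint a w - x
    rw [hexp] at h0 ⊢
    have h1 : inner ℝ (C u) (z - z') ≤ ‖C u‖ * (K * g) :=
      (real_inner_le_norm _ _).trans (mul_le_mul_of_nonneg_left hd (norm_nonneg _))
    rw [inner_sub_right] at h1
    have h2 : ‖C u‖ * (K * g) - ν / 2 * ‖C u‖ ^ 2 ≤ K ^ 2 / (2 * ν) * g ^ 2 := by
      have e : K ^ 2 / (2 * ν) * g ^ 2 - (‖C u‖ * (K * g) - ν / 2 * ‖C u‖ ^ 2)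
          = (K * g - ν * ‖C u‖) ^ 2 / (2 * ν) := by field_simp; ring
      have : 0 ≤ (K * g - ν * ‖C u‖) ^ 2 / (2 * ν) := by positivity
      linarith
    linarith
  · obtain ⟨ε₀, hε₀, hε⟩ := exists_pos_residual_of_infeasible A β hfeas
    refine ⟨1 / ε₀, by positivity, fun w hw hwS z g hg h x hx => ?_⟩
    have h1 := hε z g ((hsys z g hg).2 h)
    have h2 := inner_atomPoint_sub_le a hw (fun i j hi => h i j (hwS i hi)) hx
    have h3 : g ≤ 1 / ε₀ * g ^ 2 := by
      rw [one_div, inv_mul_eq_div, le_div_iff₀ hε₀]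
      nlinarith
    have : 0 ≤ ν / 2 * ‖C (atomPoint a w - x)‖ ^ 2 := by positivity
    linarith

/-- **Error bound for the inner problem, uniform in the multiplier.** Let `r = C† z + b` be the
gradient at the current point of an objective that is strongly convex along `C`. The suboptimality
is at most a constant times the square of the pairwise gap `g`, and the constant does not
depend on `z`. By Hoffman's bound some `z'` with `‖z - z'‖ ≤ K g` makes the current point minimize
`C† z' + b` exactly, so only `⟪z - z', C u⟫ - ν / 2 * ‖C u‖ ^ 2 ≤ ‖z - z'‖ ^ 2 / (2 ν)` is left; if
no such `z'` exists, then `g` is bounded away from zero. -/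
theorem exists_primal_bound (a : ι → E) (C : E →L[ℝ] Z) (b : E) {ν : ℝ} (hν : 0 < ν) :
    ∃ κ : ℝ, 0 < κ ∧ ∀ w ∈ stdSimplex ℝ ι, ∀ (z : Z) (g : ℝ),
      (∀ i j, 0 < w i → inner ℝ (C.adjoint z + b) (a i - a j) ≤ g) →
      ∀ x ∈ convexHull ℝ (Set.range a),
        inner ℝ (C.adjoint z + b) (atomPoint a w - x) - ν / 2 * ‖C (atomPoint a w - x)‖ ^ 2
          ≤ κ * g ^ 2 := by
  classical
  choose κ hκ hbound using exists_primal_bound_of_support a C b hν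
  refine ⟨∑ S, κ S, Finset.sum_pos (fun S _ => hκ S) Finset.univ_nonempty,
    fun w hw z g hg x hx => ?_⟩
  have hg0 : 0 ≤ g := by
    obtain ⟨i, -, hi⟩ := Finset.exists_lt_of_sum_lt (s := Finset.univ) (f := fun _ : ι => (0 : ℝ))
      (g := w) (by simp [hw.2])
    simpa using hg i i hi
  refine (hbound (Finset.univ.filter fun i => 0 < w i) w hw (by simp) z g hg0
    (fun i j hi => hg i j (by simpa using hi)) x hx).trans ?_
  exact mul_le_mul_of_nonneg_right
    (Finset.single_le_sum (f := κ) (fun S _ => (hκ S).le) (Finset.mem_univ _)) (sq_nonneg g)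

end PrimalErrorBound

/-- A line-search step that stays below the maximal step size minimizes a convex function along the
whole ray. -/
theorem IsLineSearch.le_of_lt {φ : E → ℝ} (hφ : ConvexOn ℝ Set.univ φ) {x d : E} {γmax γ : ℝ}
    (h : IsLineSearch φ x d γmax γ) (hγ : γ < γmax) {τ : ℝ} (hτ : 0 ≤ τ) :
    φ (x + γ • d) ≤ φ (x + τ • d) := by
  rcases le_or_gt τ γmax with h1 | h1
  · exact h.2 τ ⟨hτ, h1⟩
  have hd : 0 < τ - γ := by linarith
  have hm := h.2 γmax ⟨h.1.1.trans hγ.le, le_rfl⟩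
  have hc := hφ.2 (Set.mem_univ (x + γ • d)) (Set.mem_univ (x + τ • d))
    (div_nonneg (by linarith) hd.le : 0 ≤ (τ - γmax) / (τ - γ))
    (div_nonneg (by linarith) hd.le : 0 ≤ (γmax - γ) / (τ - γ)) (by field_simp; ring)
  have e : ((τ - γmax) / (τ - γ)) • (x + γ • d) + ((γmax - γ) / (τ - γ)) • (x + τ • d)
      = x + γmax • d := by
    have e1 : (τ - γmax) / (τ - γ) = 1 - (γmax - γ) / (τ - γ) := by field_simp; ring
    have e2 : γmax = γ + (γmax - γ) / (τ - γ) * (τ - γ) := by field_simp; ring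
    rw [e1]
    conv_rhs => rw [e2]
    module
  rw [e] at hc
  simp only [smul_eq_mul] at hc
  have e3 : φ (x + γ • d) = (τ - γmax) / (τ - γ) * φ (x + γ • d)
      + (γmax - γ) / (τ - γ) * φ (x + γ • d) := by
    field_simp; ring
  have h2 : (γmax - γ) / (τ - γ) * φ (x + γ • d) ≤ (γmax - γ) / (τ - γ) * φ (x + τ • d) := by
    linarith
  exact le_of_mul_le_mul_left h2 (div_pos (by linarith) hd)

variable [CompleteSpace E]

/-- The common part of Frank-Wolfe and away steps: an exact line search along a direction whose
slope `-G` dominates the Frank-Wolfe gap and half of the pairwise gap. -/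
theorem AFWStep.exists_direction {φ : E → ℝ} {a : ι → E} {w w' : ι → ℝ} {γ γmax : ℝ}
    (h : AFWStep φ a w γ γmax w') (hw : w ∈ stdSimplex ℝ ι) :
    w' ∈ stdSimplex ℝ ι ∧ ∃ (k : ι) (σ G : ℝ), σ ^ 2 = 1 ∧
      atomPoint a w' = atomPoint a w + γ • (σ • (a k - atomPoint a w)) ∧
      IsLineSearch φ (atomPoint a w) (σ • (a k - atomPoint a w)) γmax γ ∧
      inner ℝ (gradient φ (atomPoint a w)) (σ • (a k - atomPoint a w)) = -G ∧
      (∀ i, inner ℝ (gradient φ (atomPoint a w)) (atomPoint a w - a i) ≤ G) ∧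
      ∀ i j, 0 < w i → inner ℝ (gradient φ (atomPoint a w)) (a i - a j) ≤ 2 * G := by
  classical
  obtain ⟨s, v, hs, hv0, hv, ⟨hcmp, rfl, hls, rfl⟩ | ⟨hcmp, rfl, hls, rfl⟩⟩ := h
  · set x := atomPoint a w with hx
    set r := gradient φ x
    obtain ⟨hγ0, hγ1⟩ := hls.1
    refine ⟨⟨fun i => ?_, ?_⟩, s, 1, inner ℝ r (x - a s), by norm_num, ?_, by simpa using hls, ?_,
      fun i => ?_, fun i j hi => ?_⟩
    · have := hw.1 i
      have : (0 : ℝ) ≤ if i = s then 1 else 0 := by split_ifs <;> norm_num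
      have : 0 ≤ 1 - γ := by linarith
      dsimp only
      positivity
    · simp [Finset.sum_add_distrib, ← Finset.mul_sum, hw.2]
    · have : atomPoint a (fun i => (1 - γ) * w i + γ * if i = s then 1 else 0)
          = (1 - γ) • x + γ • a s := by
        simp [atomPoint, hx, add_smul, Finset.sum_add_distrib, mul_smul, Finset.smul_sum]
      rw [this]
      module
    · simp only [one_smul, inner_sub_right]; ring
    · have := hs i
      simp only [inner_sub_right]; linarith
    · have h1 := hs j
      have h2 := hv i hi
      simp only [inner_sub_right] at hcmp ⊢
      linarith
  · set x := atomPoint a w with hx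
    set r := gradient φ x
    obtain ⟨hγ0, hγ1⟩ := hls.1
    have hwv : w v ≤ 1 := by
      rw [← hw.2]
      exact Finset.single_le_sum (fun i _ => hw.1 i) (Finset.mem_univ v)
    -- for `w v = 1` the quotient `w v / (1 - w v)` is `0`, and the step is trivial
    have hγv : γ * (1 - w v) ≤ w v := by
      rcases hwv.eq_or_lt with h1 | h1
      · rw [h1]; simp
      · rwa [le_div_iff₀ (by linarith)] at hγ1
    refine ⟨⟨fun i => ?_, ?_⟩, v, -1, inner ℝ r (a v - x), by norm_num, ?_, by simpa using hls, ?_,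
      fun i => ?_, fun i j hi => ?_⟩
    · by_cases hi : i = v
      · subst hi
        simp only [if_true]
        linarith
      · have := hw.1 i
        simp only [hi, if_false, mul_zero, sub_zero]
        positivity
    · simp [Finset.sum_sub_distrib, ← Finset.mul_sum, hw.2]
    · have : atomPoint a (fun i => (1 + γ) * w i - γ * if i = v then 1 else 0)
          = (1 + γ) • x - γ • a v := by
        simp [atomPoint, hx, sub_smul, Finset.sum_sub_distrib, mul_smul, Finset.smul_sum]
      rw [this]
      module
    · simp only [inner_smul_right, inner_sub_right]; ring
    · have := hs i
      simp only [inner_sub_right] at hcmp ⊢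
      linarith
    · have h1 := hs j
      have h2 := hv i hi
      simp only [inner_sub_right] at hcmp ⊢
      linarith

/-- What a run of the inner loop achieves: some intermediate point `x₁` is no worse than the initial
point, and the last step, which is not a drop step, decreases the objective from `x₁` at least as
much as any step of length `τ ≥ 0` along a direction of slope `-G`. -/
theorem AFW.exists_last {φ : E → ℝ} {a : ι → E} {R : ℝ} (hφ : ConvexOn ℝ Set.univ φ)
    (hR : ∀ w ∈ stdSimplex ℝ ι, ∀ (i : ι) (τ : ℝ),
      φ (atomPoint a w + τ • (a i - atomPoint a w)) ≤ φ (atomPoint a w)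
        + τ * inner ℝ (gradient φ (atomPoint a w)) (a i - atomPoint a w) + τ ^ 2 * R / 2)
    {w w' : ι → ℝ} (h : AFW φ a w w') (hw : w ∈ stdSimplex ℝ ι) :
    w' ∈ stdSimplex ℝ ι ∧ ∃ w₁ ∈ stdSimplex ℝ ι, ∃ G : ℝ,
      φ (atomPoint a w₁) ≤ φ (atomPoint a w) ∧
      (∀ i, inner ℝ (gradient φ (atomPoint a w₁)) (atomPoint a w₁ - a i) ≤ G) ∧
      (∀ i j, 0 < w₁ i → inner ℝ (gradient φ (atomPoint a w₁)) (a i - a j) ≤ 2 * G) ∧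
      ∀ τ : ℝ, 0 ≤ τ → φ (atomPoint a w') ≤ φ (atomPoint a w₁) - τ * G + τ ^ 2 * R / 2 := by
  induction h with
  | @last w w' γ γmax hstep hγ =>
    obtain ⟨hw', k, σ, G, hσ, hpt, hls, hG, hfw, hpair⟩ := hstep.exists_direction hw
    refine ⟨hw', w, hw, G, le_rfl, hfw, hpair, fun τ hτ => ?_⟩
    rw [hpt]
    refine (hls.le_of_lt hφ hγ hτ).trans ?_
    have := hR w hw k (τ * σ)
    rw [smul_smul]
    rw [inner_smul_right] at hG
    rw [mul_pow, hσ, mul_assoc τ σ, hG] at this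
    linarith
  | @drop w w' w'' γ γmax hstep hγ hnext ih =>
    obtain ⟨hw', k, σ, G, hσ, hpt, hls, -⟩ := hstep.exists_direction hw
    obtain ⟨hw'', w₁, hw₁, G₁, h1, h2⟩ := ih hw'
    refine ⟨hw'', w₁, hw₁, G₁, h1.trans ?_, h2⟩
    have := hls.2 0 ⟨le_rfl, hls.1.1.trans hls.1.2⟩
    rwa [zero_smul, add_zero, ← hpt] at this

end AwayStepAnalysis

/-! ### Smooth and generalized strongly convex functions -/

section SmoothConvex

variable {E : Type*} [NormedAddCommGroup E] [InnerProductSpace ℝ E] [CompleteSpace E]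

/-- The descent lemma for a function with Lipschitz gradient. -/
theorem le_add_inner_gradient_of_lipschitzWith {f : E → ℝ} {L : ℝ≥0} (hf : Differentiable ℝ f)
    (hL : LipschitzWith L (gradient f)) (x u : E) :
    f (x + u) ≤ f x + inner ℝ (gradient f x) u + L / 2 * ‖u‖ ^ 2 := by
  have hder : ∀ t : ℝ, HasDerivAt
      (fun t : ℝ => f (x + t • u) - t * inner ℝ (gradient f x) u - t ^ 2 * (L / 2 * ‖u‖ ^ 2))
      (inner ℝ (gradient f (x + t • u)) u - inner ℝ (gradient f x) u
        - 2 * t * (L / 2 * ‖u‖ ^ 2)) t := by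
    intro t
    have h1 : HasDerivAt (fun t : ℝ => x + t • u) u t := by
      simpa using ((hasDerivAt_id t).smul_const u).const_add x
    have h2 := (hf (x + t • u)).hasGradientAt.hasFDerivAt.comp_hasDerivAt t h1
    have h3 : HasDerivAt (fun t : ℝ => t * inner ℝ (gradient f x) u)
        (inner ℝ (gradient f x) u) t := by
      simpa using (hasDerivAt_id t).mul_const (inner ℝ (gradient f x) u)
    have h4 : HasDerivAt (fun t : ℝ => t ^ 2 * (L / 2 * ‖u‖ ^ 2))
        (2 * t * (L / 2 * ‖u‖ ^ 2)) t := by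
      simpa using (hasDerivAt_pow 2 t).mul_const (L / 2 * ‖u‖ ^ 2)
    exact (h2.sub h3).sub h4
  have hanti := antitoneOn_of_deriv_nonpos (convex_Icc (0 : ℝ) 1)
    (fun t _ => (hder t).continuousAt.continuousWithinAt)
    (fun t _ => (hder t).differentiableAt.differentiableWithinAt) (fun t ht => by
      rw [interior_Icc] at ht
      rw [(hder t).deriv, ← inner_sub_left]
      have h1 := hL.norm_sub_le (x + t • u) x
      rw [add_sub_cancel_left, norm_smul, Real.norm_of_nonneg ht.1.le] at h1
      have h2 := (real_inner_le_norm (gradient f (x + t • u) - gradient f x) u).trans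
        (mul_le_mul_of_nonneg_right h1 (norm_nonneg u))
      linarith)
  have := hanti (Set.left_mem_Icc.2 zero_le_one) (Set.right_mem_Icc.2 zero_le_one) zero_le_one
  simp only [one_smul, zero_smul, add_zero] at this
  linarith

/-- A generalized strongly convex function has its gradients in `range B† + b`, and grows
quadratically in `B x` above its tangents. -/
theorem IsGenStronglyConvex.exists_gradient {f : E → ℝ} (hf : IsGenStronglyConvex f) :
    ∃ (p : ℕ) (B : E →L[ℝ] EuclideanSpace ℝ (Fin p)) (b : E) (μ : ℝ), 0 < μ ∧
      (∀ x, ∃ z, gradient f x = B.adjoint z + b) ∧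
      ∀ x x', f x + inner ℝ (gradient f x) (x' - x) + μ / 2 * ‖B (x' - x)‖ ^ 2 ≤ f x' := by
  obtain ⟨p, B, b, g, μ, hμ, ⟨hg, hgs⟩, hfg⟩ := hf
  have hgrad : ∀ x, gradient f x = B.adjoint (gradient g (B x)) + b := by
    intro x
    apply HasGradientAt.gradient
    rw [hasGradientAt_iff_hasFDerivAt]
    have h1 := (hg (B x)).hasGradientAt.hasFDerivAt.comp x B.hasFDerivAt
    have h2 := h1.add (innerSL ℝ b).hasFDerivAt
    have hfe : f = (g ∘ B) + (innerSL ℝ b : E → ℝ) := by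
      funext x; simp [hfg]
    rw [hfe]
    refine h2.congr_fderiv ?_
    ext u
    simp [ContinuousLinearMap.adjoint_inner_left]
  refine ⟨p, B, b, μ, hμ, fun x => ⟨_, hgrad x⟩, fun x x' => ?_⟩
  have := hgs (B x') (B x)
  rw [← map_sub, real_inner_comm] at this
  rw [hgrad, hfg x, hfg x', inner_add_left, ContinuousLinearMap.adjoint_inner_left, inner_sub_right b]
  linarith

end SmoothConvex

namespace SplitProblem

variable {K d : ℕ} {n : Fin K → ℕ} (P : SplitProblem K d n)

/-! ### The polytope -/

theorem M_apply (x : BlockSpace n) : P.M x = ∑ k, P.A k (x k) := by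
  simp [M]

theorem X_eq_convexHull : P.X = convexHull ℝ (Set.range P.atom) := by
  have h1 : Set.range P.atom = (WithLp.linearEquiv 2 ℝ
      (∀ k, EuclideanSpace ℝ (Fin (n k)))).symm.toLinearMap ''
      (Set.univ.pi fun k => (P.V k : Set (EuclideanSpace ℝ (Fin (n k))))) := by
    ext x
    constructor
    · rintro ⟨i, rfl⟩
      exact ⟨fun k => (i k).1, fun k _ => (i k).2, rfl⟩
    · rintro ⟨v, hv, rfl⟩
      exact ⟨fun k => ⟨v k, hv k trivial⟩, rfl⟩
  rw [h1, ← LinearMap.image_convexHull, convexHull_pi]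
  ext x
  constructor
  · intro hx
    exact ⟨fun k => x k, fun k _ => hx k, rfl⟩
  · rintro ⟨v, hv, rfl⟩ k
    exact hv k trivial

theorem isCompact_X : IsCompact P.X := by
  rw [X_eq_convexHull]
  exact (Set.finite_range _).isCompact_convexHull ℝ

theorem convex_X : Convex ℝ P.X := by
  rw [X_eq_convexHull]
  exact convex_convexHull ℝ _

theorem atom_mem_X (i : P.AtomIdx) : P.atom i ∈ P.X := by
  rw [X_eq_convexHull]
  exact subset_convexHull ℝ _ ⟨i, rfl⟩

theorem atomPoint_mem_X {w : P.AtomIdx → ℝ} (hw : w ∈ stdSimplex ℝ P.AtomIdx) :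
    atomPoint P.atom w ∈ P.X := by
  rw [X_eq_convexHull]
  exact atomPoint_mem_convexHull _ hw

theorem Slater.exists_feasible {P : SplitProblem K d n} (h : P.Slater) :
    ∃ x ∈ P.X, P.M x = 0 := by
  obtain ⟨x, hx, h0⟩ := h
  exact ⟨x, fun k => intrinsicInterior_subset (hx k), by rw [M_apply, h0]⟩

/-! ### First-order properties of the augmented Lagrangian -/

theorem gradient_lagr (hdiff : Differentiable ℝ P.f) (x : BlockSpace n)
    (y : EuclideanSpace ℝ (Fin d)) :
    gradient (fun x => P.lagr x y) x
      = gradient P.f x + P.M.adjoint (y + P.lam • P.M x) := by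
  apply HasGradientAt.gradient
  rw [hasGradientAt_iff_hasFDerivAt]
  have h1 := (hdiff x).hasGradientAt.hasFDerivAt
  have h2 := ((innerSL ℝ y).comp P.M).hasFDerivAt (x := x)
  have h3 := ((P.M.hasFDerivAt (x := x)).norm_sq).const_mul (P.lam / 2)
  refine HasFDerivAt.congr_fderiv (f := fun x => P.lagr x y) ((h1.add h2).add h3) ?_
  ext u
  simp [ContinuousLinearMap.adjoint_inner_left]
  ring

theorem inner_gradient_lagr (hdiff : Differentiable ℝ P.f) (x u : BlockSpace n)
    (y : EuclideanSpace ℝ (Fin d)) :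
    inner ℝ (gradient (fun x => P.lagr x y) x) u
      = inner ℝ (gradient P.f x) u + inner ℝ y (P.M u) + P.lam * inner ℝ (P.M x) (P.M u) := by
  rw [gradient_lagr P hdiff, inner_add_left, ContinuousLinearMap.adjoint_inner_left,
    inner_add_left, real_inner_smul_left, add_assoc]

theorem lagr_add (x u : BlockSpace n) (y : EuclideanSpace ℝ (Fin d)) :
    P.lagr (x + u) y = P.lagr x y + (P.f (x + u) - P.f x) + inner ℝ y (P.M u)
      + P.lam * inner ℝ (P.M x) (P.M u) + P.lam / 2 * ‖P.M u‖ ^ 2 := by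
  rw [lagr, lagr, map_add, inner_add_right, norm_add_sq_real]
  ring

theorem lagr_add_le {L : ℝ≥0} (hlam : 0 < P.lam) (hdiff : Differentiable ℝ P.f)
    (hsmooth : LipschitzWith L (gradient P.f)) (x u : BlockSpace n)
    (y : EuclideanSpace ℝ (Fin d)) :
    P.lagr (x + u) y ≤ P.lagr x y + inner ℝ (gradient (fun x => P.lagr x y) x) u
      + (L + P.lam * ‖(ContinuousLinearMap.adjoint P.M).comp P.M‖) / 2 * ‖u‖ ^ 2 := by
  have h1 := le_add_inner_gradient_of_lipschitzWith hdiff hsmooth x u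
  have h2 : ‖P.M u‖ ^ 2 ≤ ‖(ContinuousLinearMap.adjoint P.M).comp P.M‖ * ‖u‖ ^ 2 := by
    rw [ContinuousLinearMap.norm_adjoint_comp_self, ← sq, ← mul_pow]
    exact pow_le_pow_left₀ (norm_nonneg _) (P.M.le_opNorm u) 2
  have h3 := mul_le_mul_of_nonneg_left h2 (by positivity : 0 ≤ P.lam / 2)
  rw [lagr_add, inner_gradient_lagr P hdiff]
  linarith

/-- Along a chord from `x ∈ X` to an atom, `L_λ ‖u‖²` is at most `L_λ D²`. -/
theorem lagr_add_smul_atom_le {L : ℝ≥0} (hlam : 0 < P.lam) (hdiff : Differentiable ℝ P.f)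
    (hsmooth : LipschitzWith L (gradient P.f)) {x : BlockSpace n} (hx : x ∈ P.X) (i : P.AtomIdx)
    (τ : ℝ) (y : EuclideanSpace ℝ (Fin d)) :
    P.lagr (x + τ • (P.atom i - x)) y ≤ P.lagr x y
      + τ * inner ℝ (gradient (fun x => P.lagr x y) x) (P.atom i - x) + τ ^ 2 * P.LD2 L / 2 := by
  have h1 := lagr_add_le P hlam hdiff hsmooth x (τ • (P.atom i - x)) y
  have h2 : ‖P.atom i - x‖ ^ 2 ≤ Metric.diam P.X ^ 2 := by
    rw [← dist_eq_norm]
    exact pow_le_pow_left₀ dist_nonneg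
      (Metric.dist_le_diam_of_mem P.isCompact_X.isBounded (P.atom_mem_X i) hx) 2
  have h3 := mul_le_mul_of_nonneg_left h2 (by positivity : 0 ≤ τ ^ 2 *
    ((L + P.lam * ‖(ContinuousLinearMap.adjoint P.M).comp P.M‖) / 2))
  rw [inner_smul_right, norm_smul, mul_pow, Real.norm_eq_abs, sq_abs] at h1
  rw [LD2]
  linarith

/-- The augmented Lagrangian is strongly convex along one linear map `C`, for all multipliers at
once, and its gradients lie in a translate of the range of `C†` which does not depend on the
multiplier either: `C = (B, M)`. -/
theorem exists_strong_convexity (hlam : 0 < P.lam) (hdiff : Differentiable ℝ P.f)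
    (hgsc : IsGenStronglyConvex P.f) :
    ∃ (p : ℕ)
      (C : BlockSpace n →L[ℝ] WithLp 2 (EuclideanSpace ℝ (Fin p) × EuclideanSpace ℝ (Fin d)))
      (b : BlockSpace n) (ν : ℝ), 0 < ν ∧
      (∀ x y, ∃ z, gradient (fun x => P.lagr x y) x = C.adjoint z + b) ∧
      ∀ x x' y, P.lagr x y + inner ℝ (gradient (fun x => P.lagr x y) x) (x' - x)
        + ν / 2 * ‖C (x' - x)‖ ^ 2 ≤ P.lagr x' y := by
  obtain ⟨p, B, b, μ, hμ, hB, hlow⟩ := hgsc.exists_gradient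
  let C : BlockSpace n →L[ℝ] WithLp 2 (EuclideanSpace ℝ (Fin p) × EuclideanSpace ℝ (Fin d)) :=
    (WithLp.prodContinuousLinearEquiv 2 ℝ _ _).symm.toContinuousLinearMap.comp (B.prod P.M)
  have hC : ∀ u, C u = WithLp.toLp 2 (B u, P.M u) := fun u => rfl
  have hCn : ∀ u, ‖C u‖ ^ 2 = ‖B u‖ ^ 2 + ‖P.M u‖ ^ 2 := fun u =>
    WithLp.prod_norm_sq_eq_of_L2 (C u)
  refine ⟨p, C, b, min μ P.lam, lt_min hμ hlam, fun x y => ?_, fun x x' y => ?_⟩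
  · obtain ⟨z, hz⟩ := hB x
    refine ⟨WithLp.toLp 2 (z, y + P.lam • P.M x), ?_⟩
    rw [gradient_lagr P hdiff, hz]
    refine ext_inner_right ℝ fun u => ?_
    simp only [inner_add_left, ContinuousLinearMap.adjoint_inner_left, hC,
      WithLp.prod_inner_apply]
    ring
  · have h1 := hlow x x'
    have h2 := P.lagr_add x (x' - x) y
    rw [add_sub_cancel] at h2
    rw [h2, inner_gradient_lagr P hdiff, hCn]
    have h3 : min μ P.lam / 2 * ‖B (x' - x)‖ ^ 2 ≤ μ / 2 * ‖B (x' - x)‖ ^ 2 := by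
      gcongr; exact min_le_left _ _
    have h4 : min μ P.lam / 2 * ‖P.M (x' - x)‖ ^ 2 ≤ P.lam / 2 * ‖P.M (x' - x)‖ ^ 2 := by
      gcongr; exact min_le_right _ _
    linarith

theorem lagr_add_inner_gradient_le (hdiff : Differentiable ℝ P.f)
    (hgsc : IsGenStronglyConvex P.f) (x x' : BlockSpace n) (y : EuclideanSpace ℝ (Fin d)) :
    P.lagr x y + inner ℝ (gradient (fun x => P.lagr x y) x) (x' - x)
      + P.lam / 2 * ‖P.M (x' - x)‖ ^ 2 ≤ P.lagr x' y := by
  obtain ⟨p, B, b, μ, hμ, -, hlow⟩ := hgsc.exists_gradient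
  have h1 := hlow x x'
  have h2 := P.lagr_add x (x' - x) y
  rw [add_sub_cancel] at h2
  rw [h2, inner_gradient_lagr P hdiff]
  have : 0 ≤ μ / 2 * ‖B (x' - x)‖ ^ 2 := by positivity
  linarith

theorem convexOn_lagr (hlam : 0 < P.lam) (hconv : ConvexOn ℝ Set.univ P.f)
    (y : EuclideanSpace ℝ (Fin d)) : ConvexOn ℝ Set.univ (fun x => P.lagr x y) := by
  have h1 : ConvexOn ℝ Set.univ (fun x => inner ℝ y (P.M x)) :=
    ((innerSL ℝ y).comp P.M).toLinearMap.convexOn convex_univ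
  have h2 : ConvexOn ℝ Set.univ (fun x => ‖P.M x‖ ^ 2) :=
    ((convexOn_univ_norm (E := EuclideanSpace ℝ (Fin d))).pow
      (fun _ _ => norm_nonneg _) 2).comp_linearMap P.M.toLinearMap
  exact (hconv.add h1).add (h2.smul (by positivity : 0 ≤ P.lam / 2))

theorem continuous_lagr (hdiff : Differentiable ℝ P.f) (y : EuclideanSpace ℝ (Fin d)) :
    Continuous (fun x => P.lagr x y) := by
  have := hdiff.continuous
  unfold lagr
  fun_prop

end SplitProblem

theorem nonneg_of_forall_mul_add_sq {a b : ℝ}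
    (h : ∀ t : ℝ, 0 < t → t ≤ 1 → 0 ≤ t * a + t ^ 2 * b) : 0 ≤ a := by
  by_contra! ha
  set t := min 1 (-a / (2 * (|b| + 1))) with ht
  have hb := abs_nonneg b
  have ht0 : 0 < t := lt_min one_pos (div_pos (by linarith) (by linarith))
  have h1 : t * (2 * (|b| + 1)) ≤ -a := by
    rw [← le_div_iff₀ (by linarith)]
    exact min_le_right _ _
  have h2 := h t ht0 (min_le_left _ _)
  have h3 : 0 ≤ t * (a + t * b) := by linarith
  have h4 := nonneg_of_mul_nonneg_right h3 ht0
  have h5 := mul_le_mul_of_nonneg_left (le_abs_self b) ht0.le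
  have h6 := mul_nonneg ht0.le hb
  linarith

namespace SplitProblem

variable {K d : ℕ} {n : Fin K → ℕ}

/-- The standing assumptions on the splitting problem. -/
structure IsAdmissible (P : SplitProblem K d n) (L : ℝ≥0) : Prop where
  lam_pos : 0 < P.lam
  convex : ConvexOn ℝ Set.univ P.f
  diff : Differentiable ℝ P.f
  smooth : LipschitzWith L (gradient P.f)
  gsc : IsGenStronglyConvex P.f
  slater : P.Slater

namespace IsAdmissible

variable {P : SplitProblem K d n} {L : ℝ≥0}

/-! ### The dual function -/

theorem LD2_nonneg (h : P.IsAdmissible L) : 0 ≤ P.LD2 L := by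
  have := h.lam_pos
  rw [LD2]
  positivity

theorem nonempty_atomIdx (h : P.IsAdmissible L) : Nonempty P.AtomIdx := by
  obtain ⟨x, hx, -⟩ := h.slater.exists_feasible
  rw [X_eq_convexHull] at hx
  exact Set.range_nonempty_iff_nonempty.1 (convexHull_nonempty_iff.1 ⟨x, hx⟩)

theorem dual_le (h : P.IsAdmissible L) {x : BlockSpace n} (hx : x ∈ P.X)
    (y : EuclideanSpace ℝ (Fin d)) : P.dual y ≤ P.lagr x y := by
  have hb : BddBelow (Set.range fun x : P.X => P.lagr x y) := by
    have := (P.isCompact_X.image (P.continuous_lagr h.diff y)).bddBelow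
    rwa [Set.image_eq_range] at this
  exact ciInf_le hb ⟨x, hx⟩

theorem exists_minimizer (h : P.IsAdmissible L) (y : EuclideanSpace ℝ (Fin d)) :
    ∃ x ∈ P.X, P.lagr x y = P.dual y := by
  obtain ⟨x₀, hx₀, -⟩ := h.slater.exists_feasible
  obtain ⟨x, hx, hmin⟩ := P.isCompact_X.exists_isMinOn ⟨x₀, hx₀⟩
    (P.continuous_lagr h.diff y).continuousOn
  refine ⟨x, hx, le_antisymm ?_ (h.dual_le hx y)⟩
  have : Nonempty P.X := ⟨⟨x₀, hx₀⟩⟩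
  exact le_ciInf fun x' => hmin x'.2

/-- `∇d(y) = M x̂`, where `x̂` minimizes `𝓛(·, y)`: the supergradient inequality. -/
theorem dual_le_add_inner (h : P.IsAdmissible L) {x : BlockSpace n} (hx : x ∈ P.X)
    {y : EuclideanSpace ℝ (Fin d)} (hxy : P.lagr x y = P.dual y) (y' : EuclideanSpace ℝ (Fin d)) :
    P.dual y' ≤ P.dual y + inner ℝ (y' - y) (P.M x) := by
  refine (h.dual_le hx y').trans (le_of_eq ?_)
  rw [← hxy, lagr, lagr, inner_sub_left]
  ring

/-- The augmented Lagrangian grows quadratically in `M x` away from its minimizers. -/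
theorem norm_sub_sq_le (h : P.IsAdmissible L) {x x' : BlockSpace n} (hx : x ∈ P.X)
    (hx' : x' ∈ P.X) {y : EuclideanSpace ℝ (Fin d)} (hxy : P.lagr x y = P.dual y) :
    P.lam / 2 * ‖P.M x' - P.M x‖ ^ 2 ≤ P.lagr x' y - P.dual y := by
  have hlow := P.lagr_add_inner_gradient_le h.diff h.gsc x x' y
  have hopt : 0 ≤ inner ℝ (gradient (fun x => P.lagr x y) x) (x' - x) := by
    refine nonneg_of_forall_mul_add_sq
      (b := (L + P.lam * ‖(ContinuousLinearMap.adjoint P.M).comp P.M‖) / 2 * ‖x' - x‖ ^ 2)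
      fun t ht0 ht1 => ?_
    have h1 := P.lagr_add_le h.lam_pos h.diff h.smooth x (t • (x' - x)) y
    have h2 := h.dual_le (P.convex_X.add_smul_sub_mem hx hx' ⟨ht0.le, ht1⟩) y
    rw [inner_smul_right, norm_smul, mul_pow, Real.norm_eq_abs, sq_abs] at h1
    linarith
  rw [map_sub] at hlow
  linarith

/-- The dual function is `1 / λ`-smooth. -/
theorem dual_ge (h : P.IsAdmissible L) {x : BlockSpace n} (hx : x ∈ P.X)
    {y : EuclideanSpace ℝ (Fin d)} (hxy : P.lagr x y = P.dual y) (y' : EuclideanSpace ℝ (Fin d)) :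
    P.dual y + inner ℝ (y' - y) (P.M x) - ‖y' - y‖ ^ 2 / (2 * P.lam) ≤ P.dual y' := by
  have hlam := h.lam_pos
  obtain ⟨x', hx', hxy'⟩ := h.exists_minimizer y'
  have h1 := h.norm_sub_sq_le hx hx' hxy
  have h2 : P.lagr x' y' = P.lagr x' y + inner ℝ (y' - y) (P.M x') := by
    rw [lagr, lagr, inner_sub_left]; ring
  have h3 : inner ℝ (y' - y) (P.M x') = inner ℝ (y' - y) (P.M x)
      + inner ℝ (y' - y) (P.M x' - P.M x) := by
    rw [inner_sub_right]; ring
  have h4 := neg_le_of_abs_le (abs_real_inner_le_norm (y' - y) (P.M x' - P.M x))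
  have h5 : 0 ≤ P.lam / 2 * ‖P.M x' - P.M x‖ ^ 2 - ‖y' - y‖ * ‖P.M x' - P.M x‖
      + ‖y' - y‖ ^ 2 / (2 * P.lam) := by
    have e : P.lam / 2 * ‖P.M x' - P.M x‖ ^ 2 - ‖y' - y‖ * ‖P.M x' - P.M x‖
        + ‖y' - y‖ ^ 2 / (2 * P.lam) = (P.lam * ‖P.M x' - P.M x‖ - ‖y' - y‖) ^ 2 / (2 * P.lam) := by
      field_simp; ring
    rw [e]; positivity
  linarith

/-! ### Strong duality and the dual error bound -/

/-- Karush-Kuhn-Tucker conditions for the splitting problem at a solution `x₀`. The constraints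
being polyhedral, the multiplier is provided by Farkas' alternative. -/
theorem exists_kkt (h : P.IsAdmissible L) :
    ∃ x₀ ∈ P.X, P.M x₀ = 0 ∧ ∃ y, ∀ i,
      inner ℝ (-(P.M (P.atom i - x₀))) y ≤ inner ℝ (gradient P.f x₀) (P.atom i - x₀) := by
  obtain ⟨x₁, hx₁, hM₁⟩ := h.slater.exists_feasible
  have hcomp : IsCompact (P.X ∩ {x | P.M x = 0}) :=
    P.isCompact_X.inter_right (isClosed_eq P.M.continuous continuous_const)
  obtain ⟨x₀, ⟨hx₀, hM₀⟩, hmin⟩ := hcomp.exists_isMinOn ⟨x₁, hx₁, hM₁⟩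
    h.diff.continuous.continuousOn
  refine ⟨x₀, hx₀, hM₀, ?_⟩
  by_contra hinf
  obtain ⟨c, hc, h1, h2⟩ := exists_conic_of_infeasible _ _ hinf
  set s := ∑ i, c i with hs
  have hs0 : 0 < s := by
    refine (Finset.sum_nonneg fun i _ => hc i).lt_of_ne fun h0 => ?_
    have : ∀ i, c i = 0 := fun i => (Finset.sum_eq_zero_iff_of_nonneg fun i _ => hc i).1 h0.symm i
      (Finset.mem_univ i)
    simp [this] at h2
  -- the infeasibility certificate, normalized, is a feasible descent direction `p - x₀`
  set p := atomPoint P.atom (fun i => c i / s) with hp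
  have hpX : p ∈ P.X := P.atomPoint_mem_X
    ⟨fun i => div_nonneg (hc i) hs0.le, by rw [← Finset.sum_div, ← hs, div_self hs0.ne']⟩
  have hsp : s • (p - x₀) = ∑ i, c i • (P.atom i - x₀) := by
    simp only [hp, atomPoint, smul_sub, Finset.sum_sub_distrib, Finset.smul_sum, smul_smul,
      ← Finset.sum_smul, ← hs]
    congr 1
    refine Finset.sum_congr rfl fun i _ => ?_
    rw [mul_div_cancel₀ _ hs0.ne']
  have hMp : P.M (p - x₀) = 0 := by
    have : s • P.M (p - x₀) = 0 := by
      rw [← map_smul, hsp, map_sum]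
      simp only [smul_neg, Finset.sum_neg_distrib, neg_eq_zero] at h1
      simpa only [map_smul] using h1
    exact (smul_eq_zero.1 this).resolve_left hs0.ne'
  have hslope : s * inner ℝ (gradient P.f x₀) (p - x₀) = -1 := by
    rw [← real_inner_smul_right, hsp, inner_sum, ← h2]
    simp only [real_inner_smul_right]
  have hge : 0 ≤ inner ℝ (gradient P.f x₀) (p - x₀) := by
    refine nonneg_of_forall_mul_add_sq (b := L / 2 * ‖p - x₀‖ ^ 2) fun t ht0 ht1 => ?_
    have h3 := le_add_inner_gradient_of_lipschitzWith h.diff h.smooth x₀ (t • (p - x₀))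
    have h4 : P.f x₀ ≤ P.f (x₀ + t • (p - x₀)) :=
      hmin ⟨P.convex_X.add_smul_sub_mem hx₀ hpX ⟨ht0.le, ht1⟩, by
        have hM₀' : P.M x₀ = 0 := hM₀
        show P.M _ = 0
        rw [map_add, map_smul, hMp, hM₀', smul_zero, add_zero]⟩
    rw [inner_smul_right, norm_smul, mul_pow, Real.norm_eq_abs, sq_abs] at h3
    linarith
  have := mul_nonneg hs0.le hge
  linarith

theorem inner_gradient_lagr_feasible (h : P.IsAdmissible L) {x₀ : BlockSpace n} (hM : P.M x₀ = 0)
    (y : EuclideanSpace ℝ (Fin d)) (u : BlockSpace n) :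
    inner ℝ (gradient (fun x => P.lagr x y) x₀) u
      = inner ℝ (gradient P.f x₀) u - inner ℝ (-(P.M u)) y := by
  rw [P.inner_gradient_lagr h.diff, hM, inner_neg_left, real_inner_comm y]
  simp

/-- Multipliers that satisfy the KKT conditions at `x₀` attain the value `f x₀`. -/
theorem dual_eq_of_kkt (h : P.IsAdmissible L) {x₀ : BlockSpace n} (hx₀ : x₀ ∈ P.X)
    (hM : P.M x₀ = 0) {y : EuclideanSpace ℝ (Fin d)}
    (hy : ∀ i, inner ℝ (-(P.M (P.atom i - x₀))) y ≤ inner ℝ (gradient P.f x₀) (P.atom i - x₀)) :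
    P.dual y = P.f x₀ := by
  have hl : P.lagr x₀ y = P.f x₀ := by simp [lagr, hM]
  refine le_antisymm (hl ▸ h.dual_le hx₀ y) ?_
  obtain ⟨x, hx, hxy⟩ := h.exists_minimizer y
  have h1 := P.lagr_add_inner_gradient_le h.diff h.gsc x₀ x y
  have h2 := inner_le_of_mem_convexHull P.atom
    (r := -gradient (fun x => P.lagr x y) x₀)
    (t := -inner ℝ (gradient (fun x => P.lagr x y) x₀) x₀) (fun i => by
      have h3 := hy i
      have h4 := h.inner_gradient_lagr_feasible hM y (P.atom i - x₀)
      rw [inner_sub_right (gradient (fun x => P.lagr x y) x₀)] at h4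
      rw [inner_neg_left]
      linarith) (P.X_eq_convexHull ▸ hx)
  rw [inner_neg_left] at h2
  rw [inner_sub_right] at h1
  have := h.lam_pos
  have : 0 ≤ P.lam / 2 * ‖P.M (x - x₀)‖ ^ 2 := by positivity
  linarith

theorem dual_le_of_feasible (h : P.IsAdmissible L) {x₀ : BlockSpace n} (hx₀ : x₀ ∈ P.X)
    (hM : P.M x₀ = 0) (y : EuclideanSpace ℝ (Fin d)) : P.dual y ≤ P.f x₀ := by
  simpa [lagr, hM] using h.dual_le hx₀ y

theorem dualSolutions_nonempty (h : P.IsAdmissible L) : P.dualSolutions.Nonempty := by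
  obtain ⟨x₀, hx₀, hM, y, hy⟩ := h.exists_kkt
  exact ⟨y, fun y' => (h.dual_le_of_feasible hx₀ hM y').trans (h.dual_eq_of_kkt hx₀ hM hy).ge⟩

theorem dual_le_dualOpt (h : P.IsAdmissible L) (y : EuclideanSpace ℝ (Fin d)) :
    P.dual y ≤ P.dualOpt := by
  obtain ⟨x₀, hx₀, hM⟩ := h.slater.exists_feasible
  exact le_ciSup ⟨P.f x₀, by rintro _ ⟨y, rfl⟩; exact h.dual_le_of_feasible hx₀ hM y⟩ y

theorem mem_dualSolutions_iff (h : P.IsAdmissible L) {y : EuclideanSpace ℝ (Fin d)} :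
    y ∈ P.dualSolutions ↔ P.dual y = P.dualOpt :=
  ⟨fun hy => le_antisymm (h.dual_le_dualOpt y) (ciSup_le hy),
    fun hy y' => (h.dual_le_dualOpt y').trans hy.ge⟩

/-- The dual error bound. At a primal solution `x₀` the dual solutions form the polyhedron of the KKT
multipliers, and its residual at `y` is the Frank-Wolfe gap `G` of `𝓛(·, y)` at `x₀`. A
Frank-Wolfe step from `x₀` gives `d* - d(y) ≥ τ G - τ² L_λ D² / 2` for `τ ∈ [0, 1]`, and Hoffman's
bound compares `G` with the distance to the solutions. -/
theorem exists_errorBound' (h : P.IsAdmissible L) : ∃ α : ℝ, 0 < α ∧ P.ErrorBound' L α := by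
  obtain ⟨x₀, hx₀, hM, hy₀⟩ := h.exists_kkt
  obtain ⟨C, hC0, hC⟩ := hoffman_bound _ _ hy₀
  refine ⟨C⁻¹, inv_pos.2 hC0, fun y => ?_⟩
  have hgap0 := sub_nonneg.2 (h.dual_le_dualOpt y)
  rcases h.LD2_nonneg.eq_or_lt with hR | hR
  · rw [← hR, div_zero]
    linarith [min_le_left 0 (C⁻¹ * Metric.infDist y P.dualSolutions)]
  have hopt : P.dualOpt = P.f x₀ := by
    obtain ⟨y₀, hy₀⟩ := hy₀
    have h1 := h.dual_eq_of_kkt hx₀ hM hy₀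
    rw [← h1, eq_comm, ← h.mem_dualSolutions_iff]
    exact fun y' => (h.dual_le_of_feasible hx₀ hM y').trans h1.ge
  have := h.nonempty_atomIdx
  obtain ⟨i, -, hi⟩ := Finset.exists_max_image (Finset.univ : Finset P.AtomIdx)
    (fun i => -inner ℝ (gradient (fun x => P.lagr x y) x₀) (P.atom i - x₀)) Finset.univ_nonempty
  set G := -inner ℝ (gradient (fun x => P.lagr x y) x₀) (P.atom i - x₀) with hG
  have hG0 : 0 ≤ G := by
    have h2 := inner_le_of_mem_convexHull P.atom
      (r := -gradient (fun x => P.lagr x y) x₀)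
      (t := G - inner ℝ (gradient (fun x => P.lagr x y) x₀) x₀) (fun j => by
        have h4 := hi j (Finset.mem_univ j)
        rw [inner_sub_right] at h4
        rw [inner_neg_left]
        linarith) (P.X_eq_convexHull ▸ hx₀)
    rw [inner_neg_left] at h2
    linarith
  have hdist : C⁻¹ * Metric.infDist y P.dualSolutions ≤ G := by
    obtain ⟨y', hy', hd⟩ := hC y G hG0 fun j => by
      have h3 := hi j (Finset.mem_univ j)
      rw [h.inner_gradient_lagr_feasible hM y] at h3
      linarith
    rw [inv_mul_le_iff₀ hC0]
    refine (Metric.infDist_le_dist_of_mem (h.mem_dualSolutions_iff.2 ?_)).trans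
      ((dist_eq_norm y y').trans_le hd)
    rw [h.dual_eq_of_kkt hx₀ hM hy', hopt]
  have hstep : ∀ τ : ℝ, 0 ≤ τ → τ ≤ 1 → τ * G - τ ^ 2 * P.LD2 L / 2 ≤ P.dualOpt - P.dual y := by
    intro τ h0 h1
    have h3 := P.lagr_add_smul_atom_le h.lam_pos h.diff h.smooth hx₀ i τ y
    have h4 := h.dual_le (P.convex_X.add_smul_sub_mem hx₀ (P.atom_mem_X i) ⟨h0, h1⟩) y
    have h5 : P.lagr x₀ y = P.f x₀ := by simp [lagr, hM]
    rw [hopt]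
    linarith
  have hd0 : 0 ≤ C⁻¹ * Metric.infDist y P.dualSolutions :=
    mul_nonneg (inv_nonneg.2 hC0.le) Metric.infDist_nonneg
  rcases le_or_gt G (P.LD2 L) with hle | hgt
  · have h6 := hstep (G / P.LD2 L) (by positivity) ((div_le_one hR).2 hle)
    have h7 : G / P.LD2 L * G - (G / P.LD2 L) ^ 2 * P.LD2 L / 2 = 1 / 2 * (G ^ 2 / P.LD2 L) := by
      field_simp; ring
    rw [h7] at h6
    refine le_trans (mul_le_mul_of_nonneg_left ((min_le_left _ _).trans ?_) (by norm_num)) h6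
    rw [← mul_pow]
    gcongr
  · have h6 := hstep 1 zero_le_one le_rfl
    have := min_le_right ((C⁻¹) ^ 2 * Metric.infDist y P.dualSolutions ^ 2 / P.LD2 L)
      (C⁻¹ * Metric.infDist y P.dualSolutions)
    linarith

/-! ### Geometric decrease of the inner loop -/

/-- The properties of one call of the inner loop, from `AFW.exists_last`. -/
theorem exists_last (h : P.IsAdmissible L) {y : EuclideanSpace ℝ (Fin d)} {w w' : P.AtomIdx → ℝ}
    (hw : w ∈ stdSimplex ℝ P.AtomIdx) (hA : AFW (fun x => P.lagr x y) P.atom w w') :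
    w' ∈ stdSimplex ℝ P.AtomIdx ∧ ∃ w₁ ∈ stdSimplex ℝ P.AtomIdx, ∃ G : ℝ,
      P.lagr (atomPoint P.atom w₁) y ≤ P.lagr (atomPoint P.atom w) y ∧
      P.lagr (atomPoint P.atom w₁) y - P.dual y ≤ G ∧
      (∀ i j, 0 < w₁ i → inner ℝ (gradient (fun x => P.lagr x y) (atomPoint P.atom w₁))
        (P.atom i - P.atom j) ≤ 2 * G) ∧
      ∀ τ : ℝ, 0 ≤ τ → P.lagr (atomPoint P.atom w') y
        ≤ P.lagr (atomPoint P.atom w₁) y - τ * G + τ ^ 2 * P.LD2 L / 2 := by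
  obtain ⟨hw', w₁, hw₁, G, h1, h2, h3, h4⟩ := hA.exists_last
    (P.convexOn_lagr h.lam_pos h.convex y)
    (fun w hw i τ => P.lagr_add_smul_atom_le h.lam_pos h.diff h.smooth (P.atomPoint_mem_X hw) i τ y)
    hw
  refine ⟨hw', w₁, hw₁, G, h1, ?_, h3, h4⟩
  obtain ⟨x, hx, hxy⟩ := h.exists_minimizer y
  have h5 := P.lagr_add_inner_gradient_le h.diff h.gsc (atomPoint P.atom w₁) x y
  have h6 := inner_le_of_mem_convexHull P.atom
    (r := -gradient (fun x => P.lagr x y) (atomPoint P.atom w₁))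
    (t := G - inner ℝ (gradient (fun x => P.lagr x y) (atomPoint P.atom w₁))
      (atomPoint P.atom w₁)) (fun i => by
      have := h2 i
      rw [inner_sub_right] at this
      rw [inner_neg_left]
      linarith) (P.X_eq_convexHull ▸ hx)
  rw [inner_neg_left] at h6
  rw [inner_sub_right] at h5
  have := h.lam_pos
  have : 0 ≤ P.lam / 2 * ‖P.M (x - atomPoint P.atom w₁)‖ ^ 2 := by positivity
  linarith

/-- After the inner loop the suboptimality is at most `L_λ D² / 2`. -/
theorem lagr_sub_dual_le (h : P.IsAdmissible L) {y : EuclideanSpace ℝ (Fin d)}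
    {w w' : P.AtomIdx → ℝ} (hw : w ∈ stdSimplex ℝ P.AtomIdx)
    (hA : AFW (fun x => P.lagr x y) P.atom w w') :
    P.lagr (atomPoint P.atom w') y - P.dual y ≤ P.LD2 L / 2 := by
  obtain ⟨-, w₁, -, G, -, h2, -, h4⟩ := h.exists_last hw hA
  have := h4 1 zero_le_one
  linarith

theorem lagr_le (h : P.IsAdmissible L) {y : EuclideanSpace ℝ (Fin d)}
    {w w' : P.AtomIdx → ℝ} (hw : w ∈ stdSimplex ℝ P.AtomIdx)
    (hA : AFW (fun x => P.lagr x y) P.atom w w') :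
    P.lagr (atomPoint P.atom w') y ≤ P.lagr (atomPoint P.atom w) y := by
  obtain ⟨-, w₁, -, G, h1, -, -, h4⟩ := h.exists_last hw hA
  have := h4 0 le_rfl
  linarith

theorem exists_geometricDecrease (h : P.IsAdmissible L) :
    ∃ ρA : ℝ, 0 < ρA ∧ ρA < 1 ∧ P.GeometricDecrease ρA := by
  obtain ⟨p, C, b, ν, hν, hgrad, hlow⟩ := P.exists_strong_convexity h.lam_pos h.diff h.gsc
  obtain ⟨κ, hκ, hb⟩ := exists_primal_bound P.atom C b hν
  have hR := h.LD2_nonneg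
  -- `L_λ D²` may vanish
  set R := P.LD2 L + 1
  have hR1 : 0 < R := by positivity
  refine ⟨min (1 / 2) (1 / (8 * κ * R)), by positivity,
    (min_le_left _ _).trans_lt (by norm_num), fun y w w' hw hA => ?_⟩
  obtain ⟨-, w₁, hw₁, G, h1, h2, h3, h4⟩ := h.exists_last hw hA
  have hopt := h.dual_le (P.atomPoint_mem_X hw₁) y
  have hG : 0 ≤ G := by linarith
  have hbound : P.lagr (atomPoint P.atom w₁) y - P.dual y ≤ κ * (2 * G) ^ 2 := by
    obtain ⟨x, hx, hxy⟩ := h.exists_minimizer y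
    obtain ⟨z, hz⟩ := hgrad (atomPoint P.atom w₁) y
    rw [hz] at h3
    have h5 := hb w₁ hw₁ z (2 * G) h3 x (P.X_eq_convexHull ▸ hx)
    have h6 := hlow (atomPoint P.atom w₁) x y
    rw [hz, ← neg_sub (atomPoint P.atom w₁) x, inner_neg_right, map_neg, norm_neg] at h6
    linarith
  have h7 := h4 (G / R) (by positivity)
  have h8 : G / R * G - (G / R) ^ 2 * P.LD2 L / 2 ≥ G ^ 2 / (2 * R) := by
    have e : G ^ 2 / (2 * R) = G / R * G - (G / R) ^ 2 * R / 2 := by field_simp; ring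
    have : (G / R) ^ 2 * P.LD2 L ≤ (G / R) ^ 2 * R := by gcongr; simp [R]
    linarith
  have h9 : 1 / (8 * κ * R) * (P.lagr (atomPoint P.atom w₁) y - P.dual y) ≤ G ^ 2 / (2 * R) := by
    calc _ ≤ 1 / (8 * κ * R) * (κ * (2 * G) ^ 2) := by gcongr
      _ = _ := by field_simp; ring
  have h10 := mul_le_mul_of_nonneg_right (min_le_right (1 / 2 : ℝ) (1 / (8 * κ * R)))
    (sub_nonneg.2 hopt)
  have h11 := mul_le_mul_of_nonneg_left h1
    (sub_nonneg.2 ((min_le_left (1 / 2 : ℝ) (1 / (8 * κ * R))).trans (by norm_num : _ ≤ (1 : ℝ))))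
  linarith

end IsAdmissible

end SplitProblem

/-! ### The recurrence for primal and dual gaps -/

/-- One step of the recurrence above the threshold `R`: a decrease by a fixed amount. -/
theorem gap_decrease_of_lt {p q p' q' R ρ a : ℝ} (hρ : 0 < ρ) (hρ1 : ρ < 1) (ha : 0 < a)
    (haR : a ≤ R) (hp' : 0 ≤ p') (hgt : R < p + q)
    (hrec : p' + q' - (p + q) ≤ -(ρ / 2 * p' + ρ * a / 8 * min (q' / R) (1 / 2)))
    (hq' : 0 ≤ q') : p' + q' - (p + q) ≤ -(ρ * a / 16) := by
  have hR : 0 < R := ha.trans_le haR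
  have hmin0 : 0 ≤ min (q' / R) (1 / 2) := by positivity
  have hm := mul_nonneg (by positivity : 0 ≤ ρ * a / 8) hmin0
  rcases le_or_gt (a / 8) p' with hpa | hpa
  · have := mul_le_mul_of_nonneg_left hpa hρ.le
    linarith
  rcases le_or_gt (R / 2) q' with hq | hq
  · have h1 : min (q' / R) (1 / 2) = 1 / 2 := min_eq_right (by rw [le_div_iff₀ hR]; linarith)
    rw [h1] at hrec
    have := mul_nonneg hρ.le hp'
    linarith
  · -- a jump across the threshold that ends below `5 R / 8`
    have : ρ * a ≤ 1 * a := mul_le_mul_of_nonneg_right hρ1.le ha.le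
    linarith

/-- One step of the recurrence below the threshold `R`: a linear decrease. -/
theorem gap_decrease_of_le {p q p' q' R ρ a : ℝ} (hρ : 0 < ρ) (ha : 0 < a) (hR : 0 < R)
    (hp' : 0 ≤ p') (hq' : 0 ≤ q') (hle : p' + q' ≤ R)
    (hrec : p' + q' - (p + q) ≤ -(ρ / 2 * p' + ρ * a / 8 * min (q' / R) (1 / 2))) :
    (p' + q') * (1 + ρ / 2 * min 1 (a / (8 * R))) ≤ p + q := by
  have hqR : q' / R ≤ 1 := (div_le_one hR).2 (by linarith)
  have hqR0 : 0 ≤ q' / R := by positivity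
  have h1 : q' / R / 2 ≤ min (q' / R) (1 / 2) := le_min (by linarith) (by linarith)
  have h2 := mul_le_mul_of_nonneg_left h1 (by positivity : 0 ≤ ρ * a / 8)
  have h3 : ρ * a / 8 * (q' / R / 2) = ρ / 2 * (a / (8 * R)) * q' := by field_simp
  have h4 : ρ / 2 * min 1 (a / (8 * R)) * p' ≤ ρ / 2 * 1 * p' := by
    gcongr; exact min_le_left _ _
  have h5 : ρ / 2 * min 1 (a / (8 * R)) * q' ≤ ρ / 2 * (a / (8 * R)) * q' := by
    gcongr; exact min_le_right _ _
  linarith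

namespace SplitProblem

variable {K d : ℕ} {n : Fin K → ℕ} {P : SplitProblem K d n} {L : ℝ≥0}

namespace IsAdmissible

/-! ### Growth of the dual function -/

/-- The dual gap is controlled by the norm of the gradient `M x̂` of the dual function. -/
theorem dual_gap_le (h : P.IsAdmissible L) {x : BlockSpace n} (hx : x ∈ P.X)
    {y : EuclideanSpace ℝ (Fin d)} (hxy : P.lagr x y = P.dual y) :
    P.dualOpt - P.dual y ≤ ‖P.M x‖ * Metric.infDist y P.dualSolutions := by
  have key : ∀ y' ∈ P.dualSolutions, P.dualOpt - P.dual y ≤ ‖P.M x‖ * dist y y' := by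
    intro y' hy'
    have h1 := h.dual_le_add_inner hx hxy y'
    rw [h.mem_dualSolutions_iff.1 hy'] at h1
    have h2 := real_inner_le_norm (y' - y) (P.M x)
    rw [dist_comm, dist_eq_norm]
    linarith
  rcases (norm_nonneg (P.M x)).eq_or_lt with h0 | h0
  · obtain ⟨y', hy'⟩ := h.dualSolutions_nonempty
    have := key y' hy'
    rw [← h0] at this ⊢
    simpa using this
  · rw [← div_le_iff₀' h0]
    refine (Metric.le_infDist h.dualSolutions_nonempty).2 fun y' hy' => ?_
    rw [div_le_iff₀' h0]
    exact key y' hy'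

theorem norm_sq_le_dual_gap (h : P.IsAdmissible L) {x : BlockSpace n} (hx : x ∈ P.X)
    {y : EuclideanSpace ℝ (Fin d)} (hxy : P.lagr x y = P.dual y) :
    P.lam / 2 * ‖P.M x‖ ^ 2 ≤ P.dualOpt - P.dual y := by
  have hlam := h.lam_pos
  have h1 := h.dual_ge hx hxy (y + P.lam • P.M x)
  have h2 := h.dual_le_dualOpt (y + P.lam • P.M x)
  rw [add_sub_cancel_left, real_inner_smul_left, real_inner_self_eq_norm_sq, norm_smul, mul_pow,
    Real.norm_eq_abs, sq_abs] at h1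
  have e : P.lam ^ 2 * ‖P.M x‖ ^ 2 / (2 * P.lam) = P.lam / 2 * ‖P.M x‖ ^ 2 := by
    field_simp
  linarith

/-- The dual gap is at most `dist² / (2 λ)`. -/
theorem dual_gap_le_sq (h : P.IsAdmissible L) (y : EuclideanSpace ℝ (Fin d)) :
    2 * P.lam * (P.dualOpt - P.dual y) ≤ Metric.infDist y P.dualSolutions ^ 2 := by
  have hlam := h.lam_pos
  rw [← Real.sqrt_le_left Metric.infDist_nonneg]
  refine (Metric.le_infDist h.dualSolutions_nonempty).2 fun y' hy' => ?_
  rw [Real.sqrt_le_left dist_nonneg]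
  obtain ⟨x, hx, hxy⟩ := h.exists_minimizer y'
  rw [h.mem_dualSolutions_iff] at hy'
  have h0 := h.norm_sq_le_dual_gap hx hxy
  have hM : P.M x = 0 := by
    rw [hy', sub_self] at h0
    have h0' : ‖P.M x‖ ^ 2 ≤ 0 := by
      by_contra! hc
      have : 0 < P.lam / 2 * ‖P.M x‖ ^ 2 := by positivity
      linarith
    have := pow_eq_zero_iff (two_ne_zero) |>.1 (le_antisymm h0' (sq_nonneg _))
    exact norm_eq_zero.1 this
  have h1 := h.dual_ge hx hxy y
  rw [hM, inner_zero_right, hy'] at h1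
  rw [dist_eq_norm]
  have e : ‖y - y'‖ ^ 2 = 2 * P.lam * (‖y - y'‖ ^ 2 / (2 * P.lam)) := by field_simp
  rw [e]
  gcongr
  linarith

theorem lam_mul_norm_sq_le (h : P.IsAdmissible L) {x : BlockSpace n} (hx : x ∈ P.X) :
    P.lam * ‖P.M x‖ ^ 2 ≤ P.LD2 L := by
  have hlam := h.lam_pos
  obtain ⟨x₀, hx₀, hM⟩ := h.slater.exists_feasible
  have h1 : ‖P.M x‖ ≤ ‖P.M‖ * Metric.diam P.X := by
    have : P.M x = P.M (x - x₀) := by rw [map_sub, hM, sub_zero]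
    rw [this]
    refine (P.M.le_opNorm _).trans (mul_le_mul_of_nonneg_left ?_ (norm_nonneg _))
    rw [← dist_eq_norm]
    exact Metric.dist_le_diam_of_mem P.isCompact_X.isBounded hx hx₀
  have h2 := pow_le_pow_left₀ (norm_nonneg _) h1 2
  rw [LD2, ContinuousLinearMap.norm_adjoint_comp_self]
  calc P.lam * ‖P.M x‖ ^ 2 ≤ P.lam * (‖P.M‖ * Metric.diam P.X) ^ 2 := by gcongr
    _ ≤ L * Metric.diam P.X ^ 2 + P.lam * (‖P.M‖ * Metric.diam P.X) ^ 2 :=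
        le_add_of_nonneg_left (by positivity)
    _ = _ := by ring

theorem LD2_pos_of_lt (h : P.IsAdmissible L) {y : EuclideanSpace ℝ (Fin d)}
    (hy : P.dual y < P.dualOpt) : 0 < P.LD2 L := by
  have hlam := h.lam_pos
  obtain ⟨x, hx, hxy⟩ := h.exists_minimizer y
  have h1 := h.dual_gap_le hx hxy
  have h2 : ‖P.M x‖ ≠ 0 := fun h0 => by rw [h0, zero_mul] at h1; linarith
  have : 0 < P.lam * ‖P.M x‖ ^ 2 := by positivity
  exact this.trans_le (h.lam_mul_norm_sq_le hx)

/-- Unless every multiplier is optimal, the error bound forces `λ α² ≤ L_λ D²`: near the solutions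
the dual gap is at most `dist² / (2 λ)`. -/
theorem lam_mul_sq_le (h : P.IsAdmissible L) {α : ℝ} (hα : 0 < α) (hE : P.ErrorBound' L α)
    {y : EuclideanSpace ℝ (Fin d)} (hy : P.dual y < P.dualOpt) : P.lam * α ^ 2 ≤ P.LD2 L := by
  have hlam := h.lam_pos
  have hR := h.LD2_pos_of_lt hy
  have hpos : 0 < Metric.infDist y P.dualSolutions := by
    refine Metric.infDist_nonneg.lt_of_ne fun h0 => ?_
    have h1 := h.dual_gap_le_sq y
    rw [← h0] at h1
    have : 0 < 2 * P.lam * (P.dualOpt - P.dual y) := mul_pos (by linarith) (by linarith)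
    linarith
  obtain ⟨y₀, hy₀⟩ := h.dualSolutions_nonempty
  have hcont : ContinuousOn
      (fun t : ℝ => Metric.infDist (y₀ + t • (y - y₀)) P.dualSolutions) (Set.Icc 0 1) :=
    (Metric.continuous_infDist_pt _ |>.comp (by fun_prop)).continuousOn
  set e := min (Metric.infDist y P.dualSolutions) (P.LD2 L / α) with he
  have he0 : 0 < e := lt_min hpos (by positivity)
  have hmem : e ∈ Set.Icc (Metric.infDist (y₀ + (0 : ℝ) • (y - y₀)) P.dualSolutions)
      (Metric.infDist (y₀ + (1 : ℝ) • (y - y₀)) P.dualSolutions) := by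
    rw [zero_smul, add_zero, one_smul, add_sub_cancel, Metric.infDist_zero_of_mem hy₀]
    exact ⟨he0.le, min_le_left _ _⟩
  obtain ⟨t, -, ht⟩ := intermediate_value_Icc zero_le_one hcont hmem
  have h1 := hE (y₀ + t • (y - y₀))
  have h2 := h.dual_gap_le_sq (y₀ + t • (y - y₀))
  dsimp only at ht
  rw [ht] at h1 h2
  have h3 : α ^ 2 * e ^ 2 / P.LD2 L ≤ α * e := by
    have : e * α ≤ P.LD2 L := (le_div_iff₀ hα).1 (min_le_right _ _)
    rw [div_le_iff₀ hR]
    calc α ^ 2 * e ^ 2 = α * e * (e * α) := by ring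
      _ ≤ _ := by gcongr
  rw [min_eq_left h3] at h1
  have h4 : P.lam * (α ^ 2 * e ^ 2 / P.LD2 L) ≤ e ^ 2 := by
    have := mul_le_mul_of_nonneg_left h1 (by positivity : 0 ≤ 2 * P.lam)
    linarith
  rw [← mul_div_assoc, div_le_iff₀ hR, ← mul_assoc, mul_comm (e ^ 2)] at h4
  exact le_of_mul_le_mul_right h4 (by positivity)

/-- Under the error bound the dual gap controls the gradient `M x̂` of the dual function from below. -/
theorem norm_sq_ge (h : P.IsAdmissible L) {α : ℝ} (hα : 0 < α) (hE : P.ErrorBound' L α)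
    (hR : 0 < P.LD2 L) {x : BlockSpace n} (hx : x ∈ P.X)
    {y : EuclideanSpace ℝ (Fin d)} (hxy : P.lagr x y = P.dual y) :
    α ^ 2 / 2 * min ((P.dualOpt - P.dual y) / P.LD2 L) (1 / 2) ≤ ‖P.M x‖ ^ 2 := by
  set q := P.dualOpt - P.dual y with hq
  set R := P.LD2 L
  have hq0 : 0 ≤ q := sub_nonneg.2 (h.dual_le_dualOpt y)
  have h1 := h.dual_gap_le hx hxy
  have h2 := hE y
  rw [← hq] at h1 h2
  set e := Metric.infDist y P.dualSolutions
  have he0 : 0 ≤ e := Metric.infDist_nonneg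
  rcases hq0.eq_or_lt with h0 | h0
  · rw [← h0, zero_div, min_eq_left (by norm_num), mul_zero]
    positivity
  have he : 0 < e := he0.lt_of_ne fun h' => by rw [← h', mul_zero] at h1; linarith
  rcases le_or_gt (α * e) R with hc | hc
  · have h3 : α ^ 2 * e ^ 2 / R ≤ α * e := by
      rw [div_le_iff₀ hR]
      calc α ^ 2 * e ^ 2 = α * e * (α * e) := by ring
        _ ≤ _ := by gcongr
    rw [min_eq_left h3] at h2
    have h4 : α ^ 2 * e ^ 2 ≤ 2 * R * q := by
      have : α ^ 2 * e ^ 2 / R ≤ 2 * q := by linarith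
      rw [div_le_iff₀ hR] at this
      linarith
    have h5 : q ^ 2 ≤ ‖P.M x‖ ^ 2 * e ^ 2 := by
      rw [← mul_pow]; exact pow_le_pow_left₀ hq0 h1 2
    have h6 : α ^ 2 * q * q ≤ 2 * R * ‖P.M x‖ ^ 2 * q := by
      calc α ^ 2 * q * q = α ^ 2 * q ^ 2 := by ring
        _ ≤ α ^ 2 * (‖P.M x‖ ^ 2 * e ^ 2) := by gcongr
        _ = ‖P.M x‖ ^ 2 * (α ^ 2 * e ^ 2) := by ring
        _ ≤ ‖P.M x‖ ^ 2 * (2 * R * q) := by gcongr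
        _ = _ := by ring
    have h7 := le_of_mul_le_mul_right h6 h0
    calc α ^ 2 / 2 * min (q / R) (1 / 2) ≤ α ^ 2 / 2 * (q / R) := by
          gcongr; exact min_le_left _ _
      _ = α ^ 2 * q / (2 * R) := by field_simp
      _ ≤ ‖P.M x‖ ^ 2 := by rw [div_le_iff₀ (by positivity)]; linarith
  · have h3 : α * e ≤ α ^ 2 * e ^ 2 / R := by
      rw [le_div_iff₀ hR]
      calc α * e * R ≤ α * e * (α * e) := by gcongr
        _ = _ := by ring
    rw [min_eq_right h3] at h2
    have h4 : α / 2 ≤ ‖P.M x‖ := le_of_mul_le_mul_right (by linarith) he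
    calc α ^ 2 / 2 * min (q / R) (1 / 2) ≤ α ^ 2 / 2 * (1 / 2) := by
          gcongr; exact min_le_right _ _
      _ = (α / 2) ^ 2 := by ring
      _ ≤ _ := by gcongr

/-! ### Runs of the algorithm -/

theorem weights_mem (h : P.IsAdmissible L) {η : ℝ} {w : ℕ → P.AtomIdx → ℝ}
    {y : ℕ → EuclideanSpace ℝ (Fin d)} (hrun : P.IsRun η w y) (t : ℕ) :
    w t ∈ stdSimplex ℝ P.AtomIdx := by
  induction t with
  | zero => exact hrun.init
  | succ t ih => exact (h.exists_last ih (hrun.primal t)).1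

theorem primal_gap_nonneg (h : P.IsAdmissible L) {η : ℝ} {w : ℕ → P.AtomIdx → ℝ}
    {y : ℕ → EuclideanSpace ℝ (Fin d)} (hrun : P.IsRun η w y) (t : ℕ) :
    0 ≤ P.lagr (atomPoint P.atom (w (t + 1))) (y t) - P.dual (y t) :=
  sub_nonneg.2 (h.dual_le (P.atomPoint_mem_X (h.weights_mem hrun (t + 1))) (y t))

theorem gap_nonneg (h : P.IsAdmissible L) {η : ℝ} {w : ℕ → P.AtomIdx → ℝ}
    {y : ℕ → EuclideanSpace ℝ (Fin d)} (hrun : P.IsRun η w y) (t : ℕ) : 0 ≤ P.gap w y t :=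
  add_nonneg (h.primal_gap_nonneg hrun t) (sub_nonneg.2 (h.dual_le_dualOpt _))

/-- The descent inequality for `Δ_t`: the dual step with `η = λ ρ_A / 4` costs at most half of the
decrease of the inner loop. Here `x` minimizes `𝓛(·, y_{t+1})`. -/
theorem gap_succ_sub_le (h : P.IsAdmissible L) {ρA : ℝ} (hρ : 0 < ρA)
    (hgeo : P.GeometricDecrease ρA) {w : ℕ → P.AtomIdx → ℝ}
    {y : ℕ → EuclideanSpace ℝ (Fin d)} (hrun : P.IsRun (P.lam * ρA / 4) w y) (t : ℕ)
    {x : BlockSpace n} (hx : x ∈ P.X) (hxy : P.lagr x (y (t + 1)) = P.dual (y (t + 1))) :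
    P.gap w y (t + 1) - P.gap w y t
      ≤ -(ρA / 2 * (P.lagr (atomPoint P.atom (w (t + 1 + 1))) (y (t + 1)) - P.dual (y (t + 1)))
        + P.lam * ρA / 4 * ‖P.M x‖ ^ 2) := by
  have hw := h.weights_mem hrun (t + 1)
  set η := P.lam * ρA / 4 with hη
  have hη0 : 0 < η := by have := h.lam_pos; positivity
  set x₁ := atomPoint P.atom (w (t + 1)) with hx₁
  have h1 := hgeo (y (t + 1)) _ _ hw (hrun.primal (t + 1))
  have h2 := h.dual_le_add_inner hx hxy (y t)
  have h3 := h.norm_sub_sq_le hx (P.atomPoint_mem_X hw) hxy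
  have h4 := h.lagr_le hw (hrun.primal (t + 1))
  rw [← hx₁] at h1 h3 h4
  have hy : y t - y (t + 1) = -(η • P.M x₁) := by rw [hrun.multiplier t]; abel
  have h5 : P.lagr x₁ (y (t + 1)) = P.lagr x₁ (y t) + η * ‖P.M x₁‖ ^ 2 := by
    rw [hrun.multiplier t, lagr, lagr, inner_add_left, real_inner_smul_left,
      real_inner_self_eq_norm_sq]
    ring
  rw [hy, inner_neg_left, real_inner_smul_left] at h2
  have h6 := norm_sub_sq_real (P.M x₁) (P.M x)
  have h7 : η * ‖P.M x₁ - P.M x‖ ^ 2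
      ≤ ρA / 2 * (P.lagr x₁ (y (t + 1)) - P.dual (y (t + 1))) := by
    have := mul_le_mul_of_nonneg_left h3 (by positivity : 0 ≤ ρA / 2)
    calc _ = ρA / 2 * (P.lam / 2 * ‖P.M x₁ - P.M x‖ ^ 2) := by rw [hη]; ring
      _ ≤ _ := this
  rw [h6] at h7
  have h8 := mul_le_mul_of_nonneg_left h4 (by positivity : 0 ≤ ρA / 2)
  simp only [gap, ← hx₁]
  linarith

theorem norm_sq_le_gap (h : P.IsAdmissible L) {η : ℝ} {w : ℕ → P.AtomIdx → ℝ}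
    {y : ℕ → EuclideanSpace ℝ (Fin d)} (hrun : P.IsRun η w y) (t : ℕ) :
    P.lam * ‖P.M (atomPoint P.atom (w (t + 1)))‖ ^ 2 ≤ 4 * P.gap w y t := by
  have hlam := h.lam_pos
  obtain ⟨x, hx, hxy⟩ := h.exists_minimizer (y t)
  have h1 := h.norm_sub_sq_le hx (P.atomPoint_mem_X (h.weights_mem hrun (t + 1))) hxy
  have h2 := h.norm_sq_le_dual_gap hx hxy
  set u := P.M (atomPoint P.atom (w (t + 1)))
  have h3 : ‖u‖ ^ 2 ≤ 2 * ‖u - P.M x‖ ^ 2 + 2 * ‖P.M x‖ ^ 2 := by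
    have := pow_le_pow_left₀ (norm_nonneg u) (norm_le_norm_sub_add u (P.M x)) 2
    linarith [sq_nonneg (‖u - P.M x‖ - ‖P.M x‖)]
  have h4 := mul_le_mul_of_nonneg_left h3 hlam.le
  simp only [gap]
  linarith

/-- The conclusion from one-step decreases before and after `t₀`. -/
theorem twoPhase_of_step (h : P.IsAdmissible L) {ρA c ρ η : ℝ} (hρA : 0 < ρA) (hρA1 : ρA < 1)
    (hρ : 0 ≤ ρ) {w : ℕ → P.AtomIdx → ℝ} {y : ℕ → EuclideanSpace ℝ (Fin d)}
    (hrun : P.IsRun η w y) (t₀ : ℕ)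
    (hfirst : ∀ t < t₀, P.LD2 L < P.gap w y t ∧ P.gap w y (t + 1) - P.gap w y t ≤ -c)
    (hlast : P.gap w y t₀ ≤ P.LD2 L)
    (hstep : ∀ t ≥ t₀, P.gap w y (t + 1) * (1 + ρ) ≤ P.gap w y t) :
    P.TwoPhase L ρA c ρ w y := by
  have hlam := h.lam_pos
  have key : ∀ t ≥ t₀, P.gap w y t ≤ P.gap w y t₀ / (1 + ρ) ^ (t - t₀) := by
    intro t ht
    induction t, ht using Nat.le_induction with
    | base => simp
    | succ t ht ih =>
      rw [Nat.sub_add_comm ht, pow_succ, ← div_div, le_div_iff₀ (by linarith)]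
      exact (hstep t ht).trans ih
  refine ⟨t₀, hfirst, hlast, fun t ht => ⟨key t ht, ?_⟩⟩
  calc ‖P.M (atomPoint P.atom (w (t + 1)))‖ ^ 2 ≤ 4 / P.lam * P.gap w y t := by
        rw [div_mul_eq_mul_div, le_div_iff₀ hlam]
        linarith [h.norm_sq_le_gap hrun t]
    _ ≤ 16 / (P.lam * ρA) * P.gap w y t := by
        refine mul_le_mul_of_nonneg_right ?_ (h.gap_nonneg hrun t)
        rw [div_le_div_iff₀ hlam (by positivity)]
        have := mul_le_mul_of_nonneg_left hρA1.le hlam.le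
        linarith
    _ ≤ _ := by
        have := key t ht
        gcongr

theorem twoPhase_of_errorBound' (h : P.IsAdmissible L) {α : ℝ} (hα : 0 < α)
    (hE : P.ErrorBound' L α) {ρA : ℝ} (hρ : 0 < ρA) (hρ1 : ρA < 1)
    (hgeo : P.GeometricDecrease ρA) {w : ℕ → P.AtomIdx → ℝ}
    {y : ℕ → EuclideanSpace ℝ (Fin d)} (hrun : P.IsRun (P.lam * ρA / 4) w y) :
    P.TwoPhase L ρA (P.lam * α ^ 2 * ρA / 16)
      (ρA / 2 * min 1 (P.lam * α ^ 2 / (8 * P.LD2 L))) w y := by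
  have hlam := h.lam_pos
  have hR0 := h.LD2_nonneg
  have hρ0 : 0 ≤ ρA / 2 * min 1 (P.lam * α ^ 2 / (8 * P.LD2 L)) := by positivity
  by_cases hall : ∀ y', P.dual y' = P.dualOpt
  · -- all multipliers are optimal: the inner loop alone puts `Δ_0` below the threshold
    have hgap : ∀ t, P.gap w y t
        = P.lagr (atomPoint P.atom (w (t + 1))) (y t) - P.dual (y t) := fun t => by
      rw [gap, hall (y t), sub_self, add_zero]
    refine h.twoPhase_of_step hρ hρ1 hρ0 hrun 0 (by simp) ?_ fun t _ => ?_
    · have := h.lagr_sub_dual_le (h.weights_mem hrun 0) (hrun.primal 0)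
      rw [hgap]
      linarith
    · obtain ⟨x, hx, hxy⟩ := h.exists_minimizer (y (t + 1))
      have h1 := h.gap_succ_sub_le hρ hgeo hrun t hx hxy
      rw [← hgap (t + 1)] at h1
      have h2 : ρA / 2 * min 1 (P.lam * α ^ 2 / (8 * P.LD2 L)) ≤ ρA / 2 * 1 := by
        gcongr; exact min_le_left _ _
      have h3 := mul_le_mul_of_nonneg_left h2 (h.gap_nonneg hrun (t + 1))
      have : 0 ≤ P.lam * ρA / 4 * ‖P.M x‖ ^ 2 := by positivity
      linarith
  · push Not at hall
    obtain ⟨y', hy'⟩ := hall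
    have hlt := (h.dual_le_dualOpt y').lt_of_ne hy'
    have hR := h.LD2_pos_of_lt hlt
    have haR := h.lam_mul_sq_le hα hE hlt
    have ha : 0 < P.lam * α ^ 2 := by positivity
    have hrec : ∀ t, P.gap w y (t + 1) - P.gap w y t ≤
        -(ρA / 2 * (P.lagr (atomPoint P.atom (w (t + 1 + 1))) (y (t + 1)) - P.dual (y (t + 1)))
          + ρA * (P.lam * α ^ 2) / 8 *
            min ((P.dualOpt - P.dual (y (t + 1))) / P.LD2 L) (1 / 2)) := by
      intro t
      obtain ⟨x, hx, hxy⟩ := h.exists_minimizer (y (t + 1))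
      have h1 := h.gap_succ_sub_le hρ hgeo hrun t hx hxy
      have h2 := mul_le_mul_of_nonneg_left (h.norm_sq_ge hα hE hR hx hxy)
        (by positivity : 0 ≤ P.lam * ρA / 4)
      linarith
    have hq : ∀ t, 0 ≤ P.dualOpt - P.dual (y t) := fun t => sub_nonneg.2 (h.dual_le_dualOpt _)
    have hphase1 : ∀ t, P.LD2 L < P.gap w y t →
        P.gap w y (t + 1) - P.gap w y t ≤ -(P.lam * α ^ 2 * ρA / 16) := fun t ht => by
      rw [mul_comm (P.lam * α ^ 2)]
      exact gap_decrease_of_lt hρ hρ1 ha haR (h.primal_gap_nonneg hrun (t + 1)) ht (hrec t)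
        (hq (t + 1))
    classical
    have hex : ∃ t, P.gap w y t ≤ P.LD2 L := by
      by_contra! hne
      have hlin : ∀ t : ℕ, P.gap w y t ≤ P.gap w y 0 - t * (P.lam * α ^ 2 * ρA / 16) := by
        intro t
        induction t with
        | zero => simp
        | succ t ih =>
          have := hphase1 t (hne t)
          push_cast
          linarith
      obtain ⟨t, ht⟩ := exists_nat_gt (P.gap w y 0 / (P.lam * α ^ 2 * ρA / 16))
      rw [div_lt_iff₀ (by positivity)] at ht
      linarith [hlin t, hne t]
    have hbelow : ∀ t ≥ Nat.find hex, P.gap w y t ≤ P.LD2 L := by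
      intro t ht
      induction t, ht using Nat.le_induction with
      | base => exact Nat.find_spec hex
      | succ t ht ih =>
        have h1 := hrec t
        have h2 := mul_nonneg (by positivity : 0 ≤ ρA / 2) (h.primal_gap_nonneg hrun (t + 1))
        have h3 : 0 ≤ min ((P.dualOpt - P.dual (y (t + 1))) / P.LD2 L) (1 / 2) :=
          le_min (div_nonneg (hq _) hR0) (by norm_num)
        have h4 := mul_nonneg (by positivity : 0 ≤ ρA * (P.lam * α ^ 2) / 8) h3
        linarith
    refine h.twoPhase_of_step hρ hρ1 hρ0 hrun (Nat.find hex) (fun t ht => ?_) (Nat.find_spec hex)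
      fun t ht => ?_
    · have := not_le.1 (Nat.find_min hex ht)
      exact ⟨this, hphase1 t this⟩
    · exact gap_decrease_of_le hρ ha hR (h.primal_gap_nonneg hrun (t + 1)) (hq (t + 1))
        (hbelow _ (ht.trans (Nat.le_succ t))) (hrec t)

end IsAdmissible

theorem TwoPhase.mono {ρA c c' ρ ρ' : ℝ} {w : ℕ → P.AtomIdx → ℝ}
    {y : ℕ → EuclideanSpace ℝ (Fin d)} (h : P.TwoPhase L ρA c ρ w y) (hP : 0 < P.lam)
    (hρA : 0 < ρA) (hgap : ∀ t, 0 ≤ P.gap w y t) (hc : c' ≤ c) (hρ' : 0 ≤ ρ') (hρ : ρ' ≤ ρ) :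
    P.TwoPhase L ρA c' ρ' w y := by
  obtain ⟨t₀, h1, h2, h3⟩ := h
  refine ⟨t₀, fun t ht => ⟨(h1 t ht).1, (h1 t ht).2.trans (neg_le_neg hc)⟩, h2, fun t ht => ?_⟩
  have h4 : P.gap w y t₀ / (1 + ρ) ^ (t - t₀) ≤ P.gap w y t₀ / (1 + ρ') ^ (t - t₀) := by
    have := hgap t₀
    gcongr
  exact ⟨(h3 t ht).1.trans h4, (h3 t ht).2.trans (by gcongr)⟩

end SplitProblem

theorem theorem3 {K d : ℕ} {n : Fin K → ℕ} (P : SplitProblem K d n) (L : ℝ≥0)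
    (hlam : 0 < P.lam)
    (hconv : ConvexOn ℝ Set.univ P.f)
    (hdiff : Differentiable ℝ P.f)
    (hsmooth : LipschitzWith L (gradient P.f))
    (hgsc : IsGenStronglyConvex P.f)
    (hslater : P.Slater) :
    P.dualSolutions.Nonempty ∧
    (∃ ρA : ℝ, 0 < ρA ∧ ρA < 1 ∧ P.GeometricDecrease ρA) ∧
    (∃ α : ℝ, 0 < α ∧ P.ErrorBound L α ∧
      ∀ ρA : ℝ, 0 < ρA → ρA < 1 → P.GeometricDecrease ρA →
        ∀ (w : ℕ → P.AtomIdx → ℝ) (y : ℕ → EuclideanSpace ℝ (Fin d)),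
          P.IsRun (P.lam * ρA / 4) w y →
          P.TwoPhase L ρA (P.lam * α ^ 2 * ρA / 8)
            (min (ρA / 2) (ρA * P.lam * α ^ 2 / (8 * P.LD2 L))) w y) ∧
    (∃ α : ℝ, 0 < α ∧ P.ErrorBound' L α) ∧
    (∀ α : ℝ, 0 < α → P.ErrorBound' L α →
      ∀ ρA : ℝ, 0 < ρA → ρA < 1 → P.GeometricDecrease ρA →
        ∀ (w : ℕ → P.AtomIdx → ℝ) (y : ℕ → EuclideanSpace ℝ (Fin d)),
          P.IsRun (P.lam * ρA / 4) w y →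
          P.TwoPhase L ρA (P.lam * α ^ 2 * ρA / 16)
            (ρA / 2 * min 1 (P.lam * α ^ 2 / (8 * P.LD2 L))) w y) := by
  have h : P.IsAdmissible L := ⟨hlam, hconv, hdiff, hsmooth, hgsc, hslater⟩
  have hR := h.LD2_nonneg
  refine ⟨h.dualSolutions_nonempty, h.exists_geometricDecrease, ?_, h.exists_errorBound',
    fun α hα hE ρA hρ hρ1 hgeo w y hrun => h.twoPhase_of_errorBound' hα hE hρ hρ1 hgeo hrun⟩
  obtain ⟨α', hα', hE⟩ := h.exists_errorBound'
  -- `α² ≤ min α' (α'² / 2)` turns the second form of the bound into the first one, and leaves a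
  -- factor `2` for the decrease and the rate
  set α := min 1 (α' / 2)
  have hα : 0 < α := by positivity
  have hα1 : α ≤ 1 := min_le_left _ _
  have hα2 : α ≤ α' / 2 := min_le_right _ _
  have hsq1 : α ^ 2 ≤ α' := by nlinarith
  have hsq2 : α ^ 2 ≤ α' ^ 2 / 2 := by nlinarith
  refine ⟨α, hα, fun y => ?_, fun ρA hρ hρ1 hgeo w y hrun => ?_⟩
  · refine le_trans ?_ (hE y)
    have he : 0 ≤ Metric.infDist y P.dualSolutions := Metric.infDist_nonneg
    have hα0 : 0 ≤ α ^ 2 := sq_nonneg _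
    have e : α ^ 2 / 2 * min (Metric.infDist y P.dualSolutions ^ 2 / P.LD2 L)
        (Metric.infDist y P.dualSolutions) = 1 / 2 * min
          (α ^ 2 * (Metric.infDist y P.dualSolutions ^ 2 / P.LD2 L))
          (α ^ 2 * Metric.infDist y P.dualSolutions) := by
      rw [← mul_min_of_nonneg _ _ hα0]; ring
    rw [e, mul_div_assoc]
    gcongr
    linarith [sq_nonneg α']
  · refine (h.twoPhase_of_errorBound' hα' hE hρ hρ1 hgeo hrun).mono hlam hρ
      (h.gap_nonneg hrun) ?_ (by positivity) ?_
    · have := mul_le_mul_of_nonneg_left hsq2 (by positivity : 0 ≤ P.lam * ρA)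
      linarith
    · have e : ρA / 2 * min 1 (P.lam * α' ^ 2 / (8 * P.LD2 L))
          = min (ρA / 2) (ρA / 2 * (P.lam * α' ^ 2 / (8 * P.LD2 L))) := by
        rw [mul_min_of_nonneg _ _ (by positivity : 0 ≤ ρA / 2), mul_one]
      rw [e]
      refine min_le_min le_rfl ?_
      have h1 : ρA * P.lam * α ^ 2 ≤ ρA * P.lam * (α' ^ 2 / 2) := by gcongr
      calc ρA * P.lam * α ^ 2 / (8 * P.LD2 L)
          ≤ ρA * P.lam * (α' ^ 2 / 2) / (8 * P.LD2 L) := by gcongr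
        _ = _ := by ring
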